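/- All matroids are finite. Two distinct elements $e$ and $f$ of a matroid $M$ are called clones (in $M$) if the permutation of the ground set that exchanges $e$ and $f$ and fixes all other elements is an automorphism of $M$. A matroid $M$ is called clone reducible if every minor $N$ of $M$ with at least two elements, other than a two-element matroid consisting of a loop and a coloop ($N\cong U_{0,1}\oplus U_{1,1}$), has a pair of clones. Let $M(K_4)$ denote the cycle matroid of the complete graph on four vertices. For a binary matroid $M$ (that is, a matroid representable over the field with two elements), the following statements are equivalent: 1. $M$ does not contain an $M(K_4)$-minor, that is, no minor of $M$ is isomorphic to $M(K_4)$; 2. $M$ is clone reducible. -/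

import Mathlib

/-- The cycle matroid `M(G)` of a simple graph `G`: its ground set is the set of edges of `G`, and
a set of edges is independent if and only if it is the edge set of a forest. -/
def SimpleGraph.cycleMatroid {V : Type*} (G : SimpleGraph V) : Matroid (Sym2 V) :=
  IndepMatroid.matroid
    { E := G.edgeSet
      Indep := fun I ↦ I ⊆ G.edgeSet ∧ (SimpleGraph.fromEdgeSet I).IsAcyclic
      indep_empty := by simp
      indep_subset := fun I J hJ hIJ ↦
        ⟨hIJ.trans hJ.1, hJ.2.anti (SimpleGraph.fromEdgeSet_mono hIJ)⟩
      indep_aug := by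
        intro I B hI hImax hB
        -- graphs and edge sets carry the same information below `G`
        have le_of (J : Set (Sym2 V)) (hJ : J ⊆ G.edgeSet) : SimpleGraph.fromEdgeSet J ≤ G := by
          intro u v h
          exact hJ ((SimpleGraph.fromEdgeSet_adj J).1 h).1
        have max_iff (J : Set (Sym2 V)) (hJ : J ⊆ G.edgeSet)
            (hJa : (SimpleGraph.fromEdgeSet J).IsAcyclic) :
            Maximal (fun I ↦ I ⊆ G.edgeSet ∧ (SimpleGraph.fromEdgeSet I).IsAcyclic) J ↔
              (SimpleGraph.fromEdgeSet J).Reachable = G.Reachable := by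
          rw [← SimpleGraph.maximal_isAcyclic_iff_reachable_eq (le_of J hJ) hJa]
          refine ⟨fun h ↦ ⟨⟨le_of J hJ, hJa⟩, fun F hF hJF ↦ ?_⟩,
            fun h ↦ ⟨⟨hJ, hJa⟩, fun K hK hJK ↦ ?_⟩⟩
          · have h1 : J ⊆ F.edgeSet := by
              intro e he
              have h2 := SimpleGraph.edgeSet_mono hJF
              rw [SimpleGraph.edgeSet_fromEdgeSet] at h2
              exact h2 ⟨he, G.not_isDiag_of_mem_edgeSet (hJ he)⟩
            have h3 := h.2 (y := F.edgeSet) ⟨SimpleGraph.edgeSet_mono hF.1, by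
              rw [SimpleGraph.fromEdgeSet_edgeSet]; exact hF.2⟩ h1
            rw [← SimpleGraph.fromEdgeSet_edgeSet F]
            exact SimpleGraph.fromEdgeSet_mono h3
          · have h1 := h.2 (y := SimpleGraph.fromEdgeSet K) ⟨le_of K hK.1, hK.2⟩
              (SimpleGraph.fromEdgeSet_mono hJK)
            have h2 := SimpleGraph.edgeSet_mono h1
            rw [SimpleGraph.edgeSet_fromEdgeSet, SimpleGraph.edgeSet_fromEdgeSet] at h2
            intro e he
            exact (h2 ⟨he, G.not_isDiag_of_mem_edgeSet (hK.1 he)⟩).1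
        rw [max_iff I hI.1 hI.2] at hImax
        have hBr := (max_iff B hB.1.1 hB.1.2).1 hB
        by_contra hcon
        have step : ∀ u v, (SimpleGraph.fromEdgeSet B).Adj u v →
            (SimpleGraph.fromEdgeSet I).Reachable u v := by
          intro u v huv
          by_contra hnr
          have hne := huv.ne
          have hmem : s(u, v) ∈ B := ((SimpleGraph.fromEdgeSet_adj B).1 huv).1
          have hnI : s(u, v) ∉ I := fun h ↦
            hnr (((SimpleGraph.fromEdgeSet_adj I).2 ⟨h, hne⟩).reachable)
          refine hcon ⟨s(u, v), ⟨hmem, hnI⟩, Set.insert_subset (hB.1.1 hmem) hI.1, ?_⟩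
          have h := SimpleGraph.IsAcyclic.sup_edge_of_not_reachable hnr hI.2
          rwa [SimpleGraph.edge, ← SimpleGraph.fromEdgeSet_union, Set.union_singleton] at h
        refine hImax ?_
        ext u v
        refine ⟨fun h ↦ h.mono (le_of I hI.1), fun h ↦ ?_⟩
        rw [← hBr] at h
        obtain ⟨p⟩ := h
        induction p with
        | nil => exact .refl _
        | cons h _ ih => exact (step _ _ h).trans ih
      indep_maximal := by
        intro X hX I hI hIX
        obtain ⟨F, hIF, hF⟩ := SimpleGraph.exists_maximal_isAcyclic_of_le_isAcyclic
          (SimpleGraph.fromEdgeSet_mono hIX) hI.2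
        have hFX : F.edgeSet ⊆ X := by
          have h := SimpleGraph.edgeSet_mono hF.1.1
          rw [SimpleGraph.edgeSet_fromEdgeSet] at h
          exact h.trans Set.sdiff_subset
        refine ⟨F.edgeSet, fun e he ↦ ?_, ⟨⟨hFX.trans hX, ?_⟩, hFX⟩, fun K hK hFK e he ↦ ?_⟩
        · have h := SimpleGraph.edgeSet_mono hIF
          rw [SimpleGraph.edgeSet_fromEdgeSet] at h
          exact h ⟨he, G.not_isDiag_of_mem_edgeSet (hI.1 he)⟩
        · rw [SimpleGraph.fromEdgeSet_edgeSet]; exact hF.1.2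
        · have h1 := hF.2 (y := SimpleGraph.fromEdgeSet K)
            ⟨SimpleGraph.fromEdgeSet_mono hK.2, hK.1.2⟩ (by
              rw [← SimpleGraph.fromEdgeSet_edgeSet F]
              exact SimpleGraph.fromEdgeSet_mono hFK)
          have h2 := SimpleGraph.edgeSet_mono h1
          rw [SimpleGraph.edgeSet_fromEdgeSet] at h2
          exact h2 ⟨he, G.not_isDiag_of_mem_edgeSet (hK.1.1 he)⟩
      subset_ground := fun I hI ↦ hI.1 }

namespace Matroid

/-- Two matroids are isomorphic if there is a bijection between their ground sets which preserves
independence in both directions. -/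
def IsIsomorphic {α β : Type*} (M : Matroid α) (N : Matroid β) : Prop :=
  ∃ φ : M.E ≃ N.E, ∀ I : Set M.E,
    M.Indep (Subtype.val '' I) ↔ N.Indep (Subtype.val '' (φ '' I))

/-- `M` has an `M(K₄)`-minor: some minor of `M` is isomorphic to the cycle matroid of the complete
graph on four vertices. -/
def HasMK4Minor {α : Type*} (M : Matroid α) : Prop :=
  ∃ N : Matroid α, N ≤m M ∧ N.IsIsomorphic (⊤ : SimpleGraph (Fin 4)).cycleMatroid

/-- A (finite) matroid is binary if it is the vector matroid of a matrix over the field with two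
elements: the columns of `A` are labelled by the elements, and a set of elements is independent
if and only if the corresponding family of columns is linearly independent. -/
def IsBinary {α : Type*} (M : Matroid α) : Prop :=
  ∃ (n : ℕ) (A : Matrix (Fin n) M.E (ZMod 2)), ∀ I : Set M.E,
    M.Indep (Subtype.val '' I) ↔ LinearIndepOn (ZMod 2) A.col I

open Classical in
/-- Two distinct elements `e`, `f` of `M` are clones if the transposition of `e` and `f` is an
automorphism of `M`. -/
def AreClones {α : Type*} (M : Matroid α) (e f : α) : Prop :=
  e ∈ M.E ∧ f ∈ M.E ∧ e ≠ f ∧ M.mapEquiv (Equiv.swap e f) = M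

/-- `M` has exactly two elements, one of them a loop and the other one a coloop, that is, `M` is
(isomorphic to) the direct sum of the uniform matroids `U₀,₁` and `U₁,₁`. -/
def IsLoopPlusColoop {α : Type*} (M : Matroid α) : Prop :=
  ∃ e f : α, e ≠ f ∧ M.E = {e, f} ∧ M.IsLoop e ∧ M.IsColoop f

/-- `M` is clone reducible if every minor of `M` with at least two elements has a pair of clones.
The two-element matroid consisting of a loop and a coloop, which occurs as a minor of every
non-uniform matroid and in which the two elements are never clones, is disregarded. -/
def IsCloneReducible {α : Type*} (M : Matroid α) : Prop :=
  ∀ N : Matroid α, N ≤m M → 2 ≤ N.E.encard → ¬ N.IsLoopPlusColoop →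
    ∃ e f : α, N.AreClones e f

end Matroid

/-! Fix a base `B` and write a binary matroid in standard form: elements of `B` are unit vectors,
and the other elements give the columns of a 0/1 matrix. This matrix is the adjacency matrix of the
bipartite fundamental graph between `B` and its complement.

Forward direction. In the fundamental graph, twins are clones, and so are a pendant vertex and its
neighbour. An induced cycle of length at least six or an induced domino yields an `M(K₄)`-minor
(`hasMK4Minor_of_hasHole`, `hasMK4Minor_of_hasDomino`). So if there is no such minor and the graph
has an edge, the theorem that bipartite graphs without holes and dominoes have a pendant vertex or
twins (`SimpleGraph.exists_pendant_or_twins`) supplies clones. If the graph has no edge, every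
element is a loop or a coloop; two of the same kind are clones, and otherwise at most one of each
kind is left. Every minor of a binary matroid is binary and inherits the excluded minor, so the
argument applies to all minors.

Converse. `M(K₄)` has no clones: for distinct edges `e`, `f` some triangle contains `e` but not `f`,
and replacing `e` by `f` turns this circuit into an independent set. -/

section
open Set Submodule

/-! ### Binary representations, their minors and standard form. -/

namespace Matroid

variable {α V W : Type*} [AddCommGroup V] [Module (ZMod 2) V] [AddCommGroup W] [Module (ZMod 2) W]
  {M N : Matroid α} {v : α → V}

/-- The family `v` of vectors over the field with two elements represents `M`. -/
def Represents (v : α → V) (M : Matroid α) : Prop :=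
  ∀ I, M.Indep I ↔ I ⊆ M.E ∧ LinearIndepOn (ZMod 2) v I

lemma IsBinary.exists_represents (h : M.IsBinary) :
    ∃ (n : ℕ) (v : α → Fin n → ZMod 2), Represents v M := by
  classical
  obtain ⟨n, A, hA⟩ := h
  obtain ⟨v, hv⟩ : ∃ v : α → Fin n → ZMod 2, v ∘ Subtype.val = A.col :=
    ⟨fun e ↦ if he : e ∈ M.E then A.col ⟨e, he⟩ else 0, by ext e : 1; simp⟩
  refine ⟨n, v, fun I ↦ ?_⟩
  by_cases hI : I ⊆ M.E
  · have h1 : Subtype.val '' (Subtype.val ⁻¹' I : Set M.E) = I := by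
      rw [Subtype.image_preimage_coe]; exact inter_eq_right.2 hI
    rw [and_iff_right hI, ← h1, hA, ← hv]
    exact ⟨fun h ↦ h.image_of_comp _ _, fun h ↦ h.comp_of_image Subtype.val_injective.injOn⟩
  · exact iff_of_false (fun h ↦ hI h.subset_ground) (fun h ↦ hI h.1)

lemma Represents.delete (h : Represents v M) (D : Set α) : Represents v (M ＼ D) := by
  intro I
  rw [delete_indep_iff, h, delete_ground, subset_sdiff]
  tauto

lemma Represents.mem_span_of_isBasis (h : Represents v M) {I X : Set α} (hI : M.IsBasis I X)
    {e : α} (he : e ∈ X) : v e ∈ span (ZMod 2) (v '' I) := by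
  by_contra hcon
  have heI : e ∉ I := fun heI ↦ hcon (subset_span (mem_image_of_mem _ heI))
  refine heI (hI.mem_of_insert_indep he ((h _).2 ⟨?_, ?_⟩))
  · exact insert_subset (hI.subset_ground he) hI.indep.subset_ground
  · exact (linearIndepOn_insert heI).2 ⟨((h _).1 hI.indep).2, hcon⟩

/-- A basis of `C` spans the same subspace as `C`, and independence modulo that subspace is
independence together with the basis. -/
lemma Represents.contract (h : Represents v M) {C : Set α} (hC : C ⊆ M.E) :
    Represents (mkQ (span (ZMod 2) (v '' C)) ∘ v) (M ／ C) := by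
  intro J
  obtain ⟨I, hI⟩ := M.exists_isBasis C
  have hspan : span (ZMod 2) (v '' I) = span (ZMod 2) (v '' C) := by
    refine le_antisymm (span_mono (image_mono hI.subset)) (span_le.2 ?_)
    rintro _ ⟨e, he, rfl⟩
    exact h.mem_span_of_isBasis hI he
  rw [hI.contract_indep_iff, contract_ground, subset_sdiff, h, union_subset_iff,
    and_iff_left hI.indep.subset_ground, disjoint_comm (a := C), ← hspan]
  by_cases hJ : Disjoint J C
  · rw [((h _).1 hI.indep).2.quotient_iff_union (hJ.mono_right hI.subset).symm, union_comm]
    tauto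
  · tauto

lemma Represents.exists_of_isMinor (h : Represents v M) (hNM : N ≤m M) :
    ∃ U : Submodule (ZMod 2) V, Represents (mkQ U ∘ v) N := by
  obtain ⟨C, D, rfl⟩ := hNM
  rw [← M.contract_inter_ground_eq]
  exact ⟨_, (h.contract inter_subset_right).delete D⟩

lemma Represents.of_comp (f : V →ₗ[ZMod 2] W) {w : α → W} (hw : Represents w M)
    (hwv : ∀ e ∈ M.E, f (v e) = w e) (hf : InjOn f (span (ZMod 2) (v '' M.E))) :
    Represents v M := by
  intro I
  rw [hw]
  refine and_congr_right fun hI ↦ ?_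
  rw [← f.linearIndepOn_iff_of_injOn (hf.mono (span_mono (image_mono hI)))]
  exact linearIndepOn_congr fun e he ↦ (hwv e (hI he)).symm

/-- Every representation can be brought into standard form with respect to a base. -/
lemma Represents.exists_standard (h : Represents v M) {B : Set α} (hB : M.IsBase B) :
    ∃ w : α → α →₀ ZMod 2, Represents w M ∧ (∀ b ∈ B, w b = Finsupp.single b 1) ∧
      ∀ e ∈ M.E, ∀ b ∉ B, w e b = 0 := by
  classical
  have hBi := ((h B).1 hB.indep).2
  have hex : ∀ e ∈ M.E, ∃ l ∈ Finsupp.supported (ZMod 2) (ZMod 2) B,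
      Finsupp.linearCombination (ZMod 2) v l = v e := fun e he ↦
    (Finsupp.mem_span_image_iff_linearCombination _).1
      (h.mem_span_of_isBasis hB.isBasis_ground he)
  choose! w hw hwv using hex
  -- Independence of `B` makes coordinates unique, so passing from `v` to coordinates loses no
  -- linear relation.
  have hinj : InjOn (Finsupp.linearCombination (ZMod 2) v)
      (Finsupp.supported (ZMod 2) (ZMod 2) B) := fun l hl l' hl' heq ↦
    linearIndepOn_iffₛ.1 hBi l hl l' hl' heq
  refine ⟨w, h.of_comp _ hwv (hinj.mono ?_), fun b hb ↦ hinj (hw b (hB.subset_ground hb)) ?_ ?_,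
    fun e he b hb ↦ ?_⟩
  · rw [SetLike.coe_subset_coe, span_le]
    rintro _ ⟨e, he, rfl⟩
    exact hw e he
  · exact Finsupp.single_mem_supported _ _ hb
  · rw [hwv b (hB.subset_ground hb), Finsupp.linearCombination_single, one_smul]
  · exact (Finsupp.mem_supported' _ _).1 (hw e he) b hb

/-- A linear injection which exchanges the vectors of `e` and `f` and fixes all the others shows
that `e` and `f` are clones. -/
lemma Represents.areClones [DecidableEq α] (h : Represents v M) {e f : α} (he : e ∈ M.E)
    (hf : f ∈ M.E) (hef : e ≠ f) (T : V →ₗ[ZMod 2] V) (hT : Function.Injective T)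
    (hTv : ∀ x ∈ M.E, T (v x) = v (Equiv.swap e f x)) : M.AreClones e f := by
  have hsub : ∀ I ⊆ M.E, Equiv.swap e f '' I ⊆ M.E := by
    rintro I hI _ ⟨x, hx, rfl⟩
    rw [Equiv.swap_apply_def]
    split_ifs
    exacts [hf, he, hI hx]
  have hss : ∀ I : Set α, Equiv.swap e f '' (Equiv.swap e f '' I) = I := fun I ↦ by
    rw [← image_comp]; simp
  have hE : Equiv.swap e f '' M.E = M.E := by
    refine (hsub _ Subset.rfl).antisymm ?_
    conv_lhs => rw [← hss M.E]
    exact image_mono (hsub _ Subset.rfl)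
  refine ⟨he, hf, hef, ?_⟩
  -- `AreClones` is stated with classical decidability of equality; here it is identified with the
  -- given instance.
  have hdec : (fun a b ↦ Classical.propDecidable (a = b)) = (inferInstance : DecidableEq α) :=
    Subsingleton.elim _ _
  rw [hdec]
  refine ext_indep (by simpa using hE) fun I hI ↦ ?_
  rw [mapEquiv_ground_eq, hE] at hI
  rw [mapEquiv_indep_iff, Equiv.symm_swap, h, h, and_iff_right (hsub I hI), and_iff_right hI]
  rw [← T.linearIndepOn_iff_of_injOn (v := v) (s := I) hT.injOn]
  rw [linearIndepOn_congr (v := T ∘ v) (w := v ∘ Equiv.swap e f) fun x hx ↦ hTv x (hI hx)]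
  refine ⟨fun h ↦ h.comp_of_image (Equiv.injective _).injOn, fun h ↦ ?_⟩
  exact LinearIndepOn.image_of_comp _ _ h

end Matroid

end

section
open Set Submodule

/-! ### Cycle matroids over the field with two elements. -/

namespace SimpleGraph
variable {X W : Type*} [AddCommGroup W]

/-- The vector of an edge, given vectors of the vertices. -/
def edgeVector (g : X → W) : Sym2 X → W :=
  Sym2.lift ⟨fun a b ↦ g a + g b, fun a b ↦ add_comm (g a) (g b)⟩

@[simp] lemma edgeVector_mk (g : X → W) (a b : X) : edgeVector g s(a, b) = g a + g b := rfl

variable [Module (ZMod 2) W]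

/-- The edge vectors along a walk telescope, because every inner vertex is counted twice. -/
lemma Reachable.add_mem_span_edgeVector (g : X → W) {I : Set (Sym2 X)} {a b : X}
    (h : (fromEdgeSet I).Reachable a b) : g a + g b ∈ span (ZMod 2) (edgeVector g '' I) := by
  obtain ⟨p⟩ := h
  induction p with
  | nil => rw [ZModModule.add_self]; exact zero_mem _
  | @cons a b c hab p ih =>
    have h1 : g a + g b ∈ span (ZMod 2) (edgeVector g '' I) :=
      subset_span ⟨s(a, b), ((fromEdgeSet_adj I).1 hab).1, rfl⟩
    have h2 := add_mem h1 ih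
    have h3 : g a + g b + (g b + g c) = g a + g c := by
      rw [add_assoc, ← add_assoc (g b), ZModModule.add_self, zero_add]
    rwa [h3] at h2

/-- The cycle matroid is represented by the edge vectors, if the differences of the vectors of
the vertices can be separated by functionals. -/
lemma cycleMatroid_indep_iff (G : SimpleGraph X) (g : X → W)
    (hg : ∀ χ : X → ZMod 2, ∃ (f : W →ₗ[ZMod 2] ZMod 2) (c : ZMod 2), ∀ x, f (g x) = χ x + c)
    (I : Set (Sym2 X)) :
    G.cycleMatroid.Indep I ↔ I ⊆ G.edgeSet ∧ LinearIndepOn (ZMod 2) (edgeVector g) I := by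
  classical
  change I ⊆ G.edgeSet ∧ (fromEdgeSet I).IsAcyclic ↔ _
  refine and_congr_right fun hI ↦ ?_
  rw [isAcyclic_iff_forall_adj_isBridge, linearIndepOn_iff_notMem_span]
  have hdel : ∀ e, (fromEdgeSet I).deleteEdges {e} = fromEdgeSet (I \ {e}) := fun e ↦ by
    ext a b
    simp only [deleteEdges_adj, fromEdgeSet_adj, mem_sdiff, mem_singleton_iff]
    tauto
  constructor
  · intro h e he hspan
    induction e with | h a b
    have hab : (fromEdgeSet I).Adj a b := (fromEdgeSet_adj I).2 ⟨he, (hI he : G.Adj a b).ne⟩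
    have hbr := h hab
    rw [isBridge_iff, hdel] at hbr
    -- For a bridge, the indicator of the component of `a` after its removal vanishes on all other
    -- edge vectors but not on `g a + g b`. The constant `c` cancels, since each edge has two ends.
    obtain ⟨f, c, hf⟩ := hg fun x ↦
      if (fromEdgeSet (I \ {s(a, b)})).Reachable a x then 1 else 0
    have hker : span (ZMod 2) (edgeVector g '' (I \ {s(a, b)})) ≤ LinearMap.ker f := by
      rw [span_le]
      rintro _ ⟨e, he', rfl⟩
      induction e with | h x y
      have hxy : (fromEdgeSet (I \ {s(a, b)})).Adj x y :=
        (fromEdgeSet_adj _).2 ⟨he', (hI he'.1 : G.Adj x y).ne⟩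
      have hiff : (fromEdgeSet (I \ {s(a, b)})).Reachable a x ↔
          (fromEdgeSet (I \ {s(a, b)})).Reachable a y :=
        ⟨fun h ↦ h.trans hxy.reachable, fun h ↦ h.trans hxy.symm.reachable⟩
      simp only [SetLike.mem_coe, LinearMap.mem_ker, edgeVector_mk, map_add, hf, hiff]
      exact ZModModule.add_self _
    have h0 : f (g a + g b) = 0 := hker hspan
    rw [map_add, hf, hf, if_pos (Reachable.refl _), if_neg hbr] at h0
    revert h0
    generalize c = c
    revert c
    decide
  · intro h a b hab
    have hmem := ((fromEdgeSet_adj I).1 hab).1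
    rw [isBridge_iff, hdel]
    exact fun hr ↦ h _ hmem (hr.add_mem_span_edgeVector g)

end SimpleGraph

/-! ### Recognising `M(K₄)`-minors, and the absence of clones in `M(K₄)`. -/

namespace Matroid
open SimpleGraph

variable {α V W : Type*} [AddCommGroup V] [Module (ZMod 2) V] [AddCommGroup W] [Module (ZMod 2) W]
  {M N : Matroid α} {v : α → V}

lemma edgeVector_injOn_of_functionals (g : Fin 4 → W)
    (hg : ∀ χ : Fin 4 → ZMod 2, ∃ (f : W →ₗ[ZMod 2] ZMod 2) (c : ZMod 2), ∀ x, f (g x) = χ x + c) :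
    InjOn (edgeVector g) (⊤ : SimpleGraph (Fin 4)).edgeSet := by
  intro e he e' he' heq
  have key : ∀ χ : Fin 4 → ZMod 2, edgeVector χ e = edgeVector χ e' := by
    intro χ
    obtain ⟨f, c, hf⟩ := hg χ
    have := congrArg f heq
    induction e with | h a b
    induction e' with | h a' b'
    simp only [edgeVector_mk, map_add, hf] at this ⊢
    have h2 : ∀ p q r s c : ZMod 2, p + c + (q + c) = r + c + (s + c) → p + q = r + s := by decide
    exact h2 _ _ _ _ _ this
  induction e with | h a b
  induction e' with | h a' b'
  have hab : a ≠ b := he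
  have hab' : a' ≠ b' := he'
  have k := fun i ↦ key (Pi.single i 1)
  simp only [edgeVector_mk] at k
  clear key he he' heq hg
  revert a b a' b'
  decide

/-- A certificate for an `M(K₄)`-minor of a represented matroid. -/
lemma Represents.hasMK4Minor (h : Represents v M) (C : Set α) (hC : C ⊆ M.E) (w : Sym2 (Fin 4) → α)
    (hw : ∀ i j, i ≠ j → w s(i, j) ∈ M.E) (g : Fin 4 → V)
    (hwg : ∀ i j, i ≠ j → v (w s(i, j)) + (g i + g j) ∈ span (ZMod 2) (v '' C))
    (hg : ∀ χ : Fin 4 → ZMod 2, ∃ (f : V →ₗ[ZMod 2] ZMod 2) (c : ZMod 2),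
      (∀ e ∈ C, f (v e) = 0) ∧ ∀ x, f (g x) = χ x + c) :
    M.HasMK4Minor := by
  set U := span (ZMod 2) (v '' C)
  set K := (⊤ : SimpleGraph (Fin 4)).edgeSet
  have hg' : ∀ χ : Fin 4 → ZMod 2, ∃ (f : (V ⧸ U) →ₗ[ZMod 2] ZMod 2) (c : ZMod 2),
      ∀ x, f (mkQ U (g x)) = χ x + c := by
    intro χ
    obtain ⟨f, c, hfC, hf⟩ := hg χ
    refine ⟨U.liftQ f (span_le.2 ?_), c, fun x ↦ ?_⟩
    · rintro _ ⟨e, he, rfl⟩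
      exact hfC e he
    · simpa using hf x
  have hvec : ∀ e ∈ K, (mkQ U ∘ v) (w e) = edgeVector (mkQ U ∘ g) e := by
    intro e he
    induction e with | h i j
    have := (Submodule.Quotient.mk_eq_zero U).2 (hwg i j he)
    rw [← mkQ_apply, map_add, map_add, add_eq_zero_iff_eq_neg] at this
    rw [Function.comp_apply, this, edgeVector_mk, neg_eq_iff_add_eq_zero]
    exact ZModModule.add_self _
  have hinj := edgeVector_injOn_of_functionals (mkQ U ∘ g) hg'
  have hwinj : InjOn w K := fun e he e' he' heq ↦ hinj he he' (by
    rw [← hvec e he, ← hvec e' he', heq])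
  have hCd : ∀ e ∈ K, w e ∉ C := by
    intro e he heC
    induction e with | h i j
    have hij : i ≠ j := he
    have h0 := hvec _ he
    rw [Function.comp_apply, mkQ_apply, (Submodule.Quotient.mk_eq_zero U).2
      (subset_span (mem_image_of_mem v heC))] at h0
    obtain ⟨f, c, hf⟩ := hg' (Pi.single i 1)
    have h1 := congrArg f h0
    rw [map_zero, edgeVector_mk, map_add, Function.comp_apply, Function.comp_apply, hf, hf,
      Pi.single_eq_same, Pi.single_eq_of_ne hij.symm] at h1
    revert h1
    generalize c = c
    revert c
    decide
  -- Contract `C` and delete all that is left except the six labelled elements.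
  have hrep := (h.contract hC).delete ((M ／ C).E \ w '' K)
  have hE : ((M ／ C) ＼ ((M ／ C).E \ w '' K)).E = w '' K := by
    rw [delete_ground, sdiff_sdiff_cancel_left]
    rintro _ ⟨e, he, rfl⟩
    refine ⟨?_, hCd e he⟩
    induction e with | h i j
    exact hw i j he
  refine ⟨_, contract_delete_isMinor M C ((M ／ C).E \ w '' K), ?_⟩
  generalize (M ／ C) ＼ ((M ／ C).E \ w '' K) = N at hE hrep
  let φ : K ≃ N.E := (BijOn.equiv w (hwinj.bijOn_image)).trans (Equiv.setCongr hE.symm)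
  have hφ : ∀ e, (φ e : α) = w e := fun e ↦ rfl
  refine ⟨φ.symm, fun I ↦ ?_⟩
  have hI : (Subtype.val '' I : Set α) = w '' (Subtype.val '' (φ.symm '' I)) := by
    ext x
    simp only [mem_image, exists_exists_and_eq_and]
    refine exists_congr fun y ↦ and_congr_right fun _ ↦ ?_
    rw [← hφ, Equiv.apply_symm_apply]
  have hK : (Subtype.val '' (φ.symm '' I) : Set (Sym2 (Fin 4))) ⊆ K := by
    rintro _ ⟨x, -, rfl⟩; exact x.2
  change _ ↔ (cycleMatroid _).Indep (Subtype.val '' (φ.symm '' I))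
  generalize (Subtype.val '' (φ.symm '' I) : Set (Sym2 (Fin 4))) = J at hI hK
  rw [hrep, cycleMatroid_indep_iff _ (mkQ U ∘ g) hg', and_iff_right hK, hI,
    and_iff_right (hE ▸ image_mono hK),
    ← linearIndepOn_congr (v := (mkQ U ∘ v) ∘ w) fun e he ↦ hvec e (hK he)]
  exact ⟨fun h ↦ h.comp_of_image (hwinj.mono hK), fun h ↦ LinearIndepOn.image_of_comp _ _ h⟩

/-- A transposition automorphism would let `e` and `f` replace each other in every independent set
that contains just one of them; a triangle through one edge that avoids the other refutes this. -/
lemma not_areClones_of_isIsomorphic_cycleMatroid_top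
    (hN : N.IsIsomorphic (⊤ : SimpleGraph (Fin 4)).cycleMatroid) (e f : α) :
    ¬ N.AreClones e f := by
  classical
  rintro ⟨he, hf, hef, hswap⟩
  obtain ⟨φ, hφ⟩ := hN
  have hg : ∀ χ : Fin 4 → ZMod 2, ∃ (f : (Fin 4 → ZMod 2) →ₗ[ZMod 2] ZMod 2) (c : ZMod 2),
      ∀ x, f (Pi.single x 1) = χ x + c := fun χ ↦
    ⟨Fintype.linearCombination (ZMod 2) χ, 0, fun x ↦ by
      simp [Fintype.linearCombination_apply, Pi.single_apply]⟩
  set g : Fin 4 → Fin 4 → ZMod 2 := fun x ↦ Pi.single x 1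
  have hinj := edgeVector_injOn_of_functionals g hg
  have key : ∀ I : Set (⊤ : SimpleGraph (Fin 4)).cycleMatroid.E, φ ⟨e, he⟩ ∉ I → φ ⟨f, hf⟩ ∉ I →
      (LinearIndepOn (ZMod 2) (edgeVector g) (insert (φ ⟨e, he⟩ : Sym2 (Fin 4)) (Subtype.val '' I)) ↔
      LinearIndepOn (ZMod 2) (edgeVector g)
        (insert (φ ⟨f, hf⟩ : Sym2 (Fin 4)) (Subtype.val '' I))) := by
    intro I heI hfI
    have main : ∀ x : N.E, (N.Indep (Subtype.val '' (insert x (φ.symm '' I))) ↔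
        LinearIndepOn (ZMod 2) (edgeVector g)
          (insert (φ x : Sym2 (Fin 4)) (Subtype.val '' I))) := by
      intro x
      rw [hφ, image_insert_eq, Equiv.image_symm_image, image_insert_eq,
        cycleMatroid_indep_iff _ g hg, and_iff_right]
      exact insert_subset (φ x).2 (by rintro _ ⟨x, -, rfl⟩; exact x.2)
    rw [← main, ← main]
    have hs : ∀ J, N.Indep J ↔ (N.mapEquiv (Equiv.swap e f)).Indep J := fun J ↦ by
      convert Iff.rfl using 2
    rw [hs, mapEquiv_indep_iff, Equiv.symm_swap, image_insert_eq, image_insert_eq, image_insert_eq]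
    have : ∀ y ∈ (Subtype.val '' (φ.symm '' I) : Set α), Equiv.swap e f y = y := by
      rintro _ ⟨_, ⟨y, hy, rfl⟩, rfl⟩
      refine Equiv.swap_apply_of_ne_of_ne (fun h ↦ heI ?_) (fun h ↦ hfI ?_)
      · have : φ.symm y = ⟨e, he⟩ := Subtype.ext h
        rwa [← this, Equiv.apply_symm_apply]
      · have : φ.symm y = ⟨f, hf⟩ := Subtype.ext h
        rwa [← this, Equiv.apply_symm_apply]
    rw [image_congr this, image_id']
    convert Iff.rfl
    simp
  have hne : φ ⟨e, he⟩ ≠ φ ⟨f, hf⟩ := fun h ↦ hef (congrArg Subtype.val (φ.injective h))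
  generalize φ ⟨e, he⟩ = e₁ at key hne
  generalize φ ⟨f, hf⟩ = f₁ at key hne
  obtain ⟨e₁, he₁⟩ := e₁
  obtain ⟨f₁, hf₁⟩ := f₁
  rw [ne_eq, Subtype.mk.injEq] at hne
  induction e₁ with | h a b
  induction f₁ with | h c d
  have hab : a ≠ b := he₁
  have hcd : c ≠ d := hf₁
  have hz : ∀ a b c d : Fin 4, a ≠ b → c ≠ d → s(a, b) ≠ s(c, d) →
      ∃ z, a ≠ z ∧ b ≠ z ∧ s(c, d) ≠ s(a, z) ∧ s(c, d) ≠ s(b, z) := by decide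
  obtain ⟨z, haz, hbz, h1, h2⟩ := hz a b c d hab hcd hne
  have haz' : s(a, z) ∈ (⊤ : SimpleGraph (Fin 4)).cycleMatroid.E := haz
  have hbz' : s(b, z) ∈ (⊤ : SimpleGraph (Fin 4)).cycleMatroid.E := hbz
  have h3 : s(a, b) ≠ s(a, z) := by simp [hbz, haz]
  have h4 : s(a, b) ≠ s(b, z) := by simp [haz, hab]
  have h5 : s(a, z) ≠ s(b, z) := by simp [haz, hab]
  have hnz : ∀ x y : Fin 4, x ≠ y → edgeVector g s(x, y) ≠ 0 := by
    intro x y hxy h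
    have := congrFun h x
    simp [g, hxy] at this
  have hsum : edgeVector g s(a, b) = edgeVector g s(a, z) + edgeVector g s(b, z) := by
    simp only [edgeVector_mk]
    rw [add_add_add_comm, ZModModule.add_self (g z), add_zero]
  have hiff : LinearIndepOn (ZMod 2) (edgeVector g) {s(a, b), s(a, z), s(b, z)} ↔
      LinearIndepOn (ZMod 2) (edgeVector g) {s(c, d), s(a, z), s(b, z)} := by
    have := key {⟨s(a, z), haz'⟩, ⟨s(b, z), hbz'⟩}
      (by rw [mem_insert_iff, mem_singleton_iff, Subtype.mk.injEq, Subtype.mk.injEq]; tauto)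
      (by rw [mem_insert_iff, mem_singleton_iff, Subtype.mk.injEq, Subtype.mk.injEq]; tauto)
    rwa [image_pair] at this
  rw [linearIndepOn_insert (a := s(a, b)) (by rw [mem_insert_iff, mem_singleton_iff]; tauto),
    linearIndepOn_insert (a := s(c, d)) (by rw [mem_insert_iff, mem_singleton_iff]; tauto),
    image_pair, mem_span_pair, mem_span_pair] at hiff
  have h6 : ∀ x : ZMod 2, x = 0 ∨ x = 1 := by decide
  refine (hiff.2 ⟨?_, ?_⟩).2 ⟨1, 1, by rw [hsum, one_smul, one_smul]⟩
  · rw [linearIndepOn_pair_iff _ h5 (hnz _ _ haz)]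
    intro x hx
    obtain rfl | rfl := h6 x
    · rw [zero_smul] at hx
      exact hnz _ _ hbz hx.symm
    · rw [one_smul] at hx
      exact h5 (hinj haz' hbz' hx)
  -- The span of two sides of the triangle contains only zero, these sides and the third side, and
  -- the edge `s(c, d)` is none of them.
  · rintro ⟨x, y, hxy⟩
    obtain rfl | rfl := h6 x <;> obtain rfl | rfl := h6 y <;>
      simp only [zero_smul, one_smul, zero_add, add_zero] at hxy
    · exact hnz _ _ hcd hxy.symm
    · exact h2 (hinj hbz' hf₁ hxy).symm
    · exact h1 (hinj haz' hf₁ hxy).symm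
    · exact hne (hinj he₁ hf₁ (hsum.trans hxy))

end Matroid

end

section
open Set

/-! ### Bipartite graphs without holes and dominoes. -/

namespace SimpleGraph
variable {α : Type*} {G : SimpleGraph α}

/-- `G` has an induced cycle with at least five vertices: the vertex `x` together with the
induced path `w 0, …, w D`. -/
def HasHole (G : SimpleGraph α) : Prop :=
  ∃ (x : α) (w : ℕ → α) (D : ℕ), 3 ≤ D ∧ InjOn w (Iic D) ∧ (∀ i ≤ D, w i ≠ x) ∧
    (∀ i ≤ D, ∀ j ≤ D, G.Adj (w i) (w j) ↔ j = i + 1 ∨ i = j + 1) ∧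
    ∀ i ≤ D, G.Adj x (w i) ↔ i = 0 ∨ i = D

/-- The closed walk `v 0, …, v 5` with the chord `v 0, v 3` and without the other two long chords.
In a bipartite graph it induces a domino. -/
def HasDomino (G : SimpleGraph α) : Prop :=
  ∃ v₀ v₁ v₂ v₃ v₄ v₅, G.Adj v₀ v₁ ∧ G.Adj v₁ v₂ ∧ G.Adj v₂ v₃ ∧ G.Adj v₃ v₄ ∧ G.Adj v₄ v₅ ∧
    G.Adj v₅ v₀ ∧ G.Adj v₀ v₃ ∧ ¬ G.Adj v₁ v₄ ∧ ¬ G.Adj v₂ v₅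

/-- The spanning subgraph whose edges are those within `U`. -/
def edgesWithin (G : SimpleGraph α) (U : Set α) : SimpleGraph α where
  Adj a b := G.Adj a b ∧ a ∈ U ∧ b ∈ U
  symm := ⟨fun _ _ h ↦ ⟨h.1.symm, h.2.2, h.2.1⟩⟩
  loopless := ⟨fun _ h ↦ G.loopless.irrefl _ h.1⟩

/-- A shortest path from `a` to `b` inside `U` is induced. It has length at least three, because its
ends are distinct, nonadjacent and without common neighbours in `U`; the vertex `x` closes it to a
hole. -/
lemma hasHole_of_reachable {U : Set α} {x a b : α} (hab : a ≠ b) (hnab : ¬ G.Adj a b)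
    (hxa : G.Adj x a) (hxb : G.Adj x b) (haU : a ∈ U) (hxU : x ∉ U)
    (hx : ∀ y ∈ U, G.Adj x y → y = a ∨ y = b) (hc : ∀ y ∈ U, G.Adj a y → ¬ G.Adj b y)
    (hr : (G.edgesWithin U).Reachable a b) : G.HasHole := by
  obtain ⟨p, hp⟩ := hr.exists_walk_length_eq_dist
  have hD : ∀ i ≤ p.length, (G.edgesWithin U).dist a (p.getVert i) = i := by
    intro i hi
    rw [← length_eq_dist_of_subwalk hp (p.isSubwalk_take i), Walk.take_length]
    omega
  have hsucc : ∀ i < p.length, (G.edgesWithin U).Adj (p.getVert i) (p.getVert (i + 1)) :=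
    fun i hi ↦ p.adj_getVert_succ hi
  have hU : ∀ i ≤ p.length, p.getVert i ∈ U := by
    intro i hi
    cases i with
    | zero => simpa using haU
    | succ i => exact (hsucc i hi).2.2
  have hinj : InjOn p.getVert (Iic p.length) := fun i hi j hj hij ↦ by
    rw [← hD i hi, ← hD j hj, hij]
  have hlast : p.getVert p.length = b := p.getVert_length
  have hfirst : p.getVert 0 = a := p.getVert_zero
  refine ⟨x, p.getVert, p.length, ?_, hinj, fun i hi h ↦ hxU (h ▸ hU i hi), ?_, ?_⟩
  · by_contra hlt
    have hcases : p.length = 0 ∨ p.length = 1 ∨ p.length = 2 := by omega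
    obtain h | h | h := hcases
    · rw [h] at hlast
      exact hab (hfirst.symm.trans hlast)
    · have := hsucc 0 (by omega)
      rw [zero_add, ← h, hlast, hfirst] at this
      exact hnab this.1
    · have h1 := hsucc 0 (by omega)
      have h2 := hsucc 1 (by omega)
      rw [show 1 + 1 = p.length by omega, hlast] at h2
      rw [zero_add, hfirst] at h1
      exact hc _ h1.2.2 h1.1 h2.1.symm
  · intro i hi j hj
    constructor
    · intro h
      have hadj : (G.edgesWithin U).Adj (p.getVert i) (p.getVert j) := ⟨h, hU i hi, hU j hj⟩
      have hne : i ≠ j := by rintro rfl; exact G.loopless.irrefl _ h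
      have := hadj.diff_dist_adj (u := a)
      rw [hD i hi, hD j hj] at this
      omega
    · rintro (rfl | rfl)
      · exact (hsucc i (by omega)).1
      · exact (hsucc j (by omega)).1.symm
  · intro i hi
    constructor
    · intro h
      obtain h | h := hx _ (hU i hi) h
      · exact Or.inl (hinj hi (mem_Iic.2 (Nat.zero_le _)) (h.trans hfirst.symm))
      · exact Or.inr (hinj hi (mem_Iic.2 le_rfl) (h.trans hlast.symm))
    · rintro (rfl | rfl)
      · rwa [hfirst]
      · rwa [hlast]

/-- The abstract properties of the distance levels of a vertex `u` of a bipartite graph. -/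
structure IsLevelStructure (G : SimpleGraph α) (u : α) (L : ℕ → α → Prop) : Prop where
  zero_iff : ∀ v, L 0 v ↔ v = u
  adj : ∀ n v w, L n v → G.Adj v w → L (n + 1) w ∨ ∃ m, n = m + 1 ∧ L m w
  exists_pred : ∀ n v, L (n + 1) v → ∃ w, G.Adj v w ∧ L n w
  unique : ∀ n m v, L n v → L m v → n = m

lemma isLevelStructure_dist {s : Set α} (hs : ∀ a b, G.Adj a b → (a ∈ s ↔ b ∉ s)) (u : α) :
    G.IsLevelStructure u fun n v ↦ G.Reachable u v ∧ G.dist u v = n where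
  zero_iff v := by
    constructor
    · rintro ⟨h, h0⟩
      exact (h.dist_eq_zero_iff.1 h0).symm
    · rintro rfl
      exact ⟨.refl _, dist_self⟩
  adj := by
    rintro n v w ⟨hv, rfl⟩ hvw
    -- Sides alternate along a walk, so equal distances from `u` would put the adjacent vertices `v`
    -- and `w` on the same side.
    have hpar : ∀ x y, ∀ p : G.Walk x y, (x ∈ s ↔ y ∈ s) ↔ Even p.length := by
      intro x y p
      induction p with
      | nil => simp
      | cons h p ih =>
        rw [Walk.length_cons, Nat.even_add_one, ← ih, hs _ _ h]
        tauto
    have hw := hv.trans hvw.reachable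
    have hne : G.dist u v ≠ G.dist u w := by
      obtain ⟨p, hp⟩ := hv.exists_walk_length_eq_dist
      obtain ⟨q, hq⟩ := hw.exists_walk_length_eq_dist
      intro heq
      have h1 := hpar _ _ p
      have h2 := hpar _ _ q
      rw [hp, heq, ← hq, ← h2] at h1
      have := hs _ _ hvw
      tauto
    have := hvw.diff_dist_adj (u := u)
    obtain h | h | h := this
    · exact absurd h.symm hne
    · exact Or.inl ⟨hw, h⟩
    · exact Or.inr ⟨G.dist u w, by omega, hw, rfl⟩
  exists_pred := by
    rintro n v ⟨hv, hn⟩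
    obtain ⟨p, hp⟩ := hv.symm.exists_walk_length_eq_dist
    rw [dist_comm, hn] at hp
    cases p with
    | nil => simp at hp
    | @cons _ w _ h p =>
      refine ⟨w, h, p.reachable.symm, ?_⟩
      have h1 := dist_le p
      have h2 := h.symm.diff_dist_adj (u := u)
      rw [Walk.length_cons] at hp
      rw [dist_comm] at h1
      omega
  unique := by
    rintro n m v ⟨-, rfl⟩ ⟨-, rfl⟩
    rfl

namespace IsLevelStructure
variable {u : α} {L : ℕ → α → Prop}

lemma not_adj (hL : G.IsLevelStructure u L) {n m : ℕ} {v w : α} (hv : L n v) (hw : L m w)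
    (h1 : m ≠ n + 1) (h2 : n ≠ m + 1) : ¬ G.Adj v w := by
  intro h
  obtain h | ⟨l, rfl, h⟩ := hL.adj n v w hv h
  · exact h1 (hL.unique _ _ _ hw h)
  · exact h2 (by rw [hL.unique _ _ _ hw h])

lemma reachable (hL : G.IsLevelStructure u L) {U : Set α} (n : ℕ)
    (hU : ∀ m ≤ n, ∀ v, L m v → v ∈ U) (v : α) (hv : L n v) :
    (G.edgesWithin U).Reachable u v := by
  induction n generalizing v with
  | zero => rw [(hL.zero_iff v).1 hv]
  | succ n ih =>
    obtain ⟨w, hvw, hw⟩ := hL.exists_pred n v hv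
    refine (ih (fun m hm ↦ hU m (by omega)) w hw).trans (Adj.reachable ?_)
    exact ⟨hvw.symm, hU n (by omega) w hw, hU _ le_rfl v hv⟩

/-- Two neighbours of a vertex in the next level have the same neighbours in the previous level. -/
lemma adj_of_adj (hL : G.IsLevelStructure u L) (hH : ¬ G.HasHole) (hD : ¬ G.HasDomino) {k : ℕ}
    {x a b p : α} (hx : L (k + 2) x) (ha : L (k + 1) a) (hb : L (k + 1) b) (hp : L k p)
    (hxa : G.Adj x a) (hxb : G.Adj x b) (hap : G.Adj a p) : G.Adj b p := by
  by_contra hbp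
  obtain ⟨q, hbq, hq⟩ := hL.exists_pred k b hb
  have hab : a ≠ b := by rintro rfl; exact hbp hap
  have hpq : p ≠ q := by rintro rfl; exact hbp hbq
  -- At level zero `p` and `q` are both the root. Afterwards `k` is shifted by one: `p` and `q` lie
  -- in level `k + 1`, just above the levels collected in `U`.
  obtain _ | k := k
  · exact hpq (((hL.zero_iff _).1 hp).trans ((hL.zero_iff _).1 hq).symm)
  let U : Set α := {v | ∃ m ≤ k, L m v}
  have hUn : ∀ v ∈ U, ∀ n, L n v → n ≤ k := by
    rintro v ⟨m, hm, hv⟩ n hn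
    rwa [hL.unique _ _ _ hn hv]
  have hr : ∀ U', U ⊆ U' → p ∈ U' → q ∈ U' → (G.edgesWithin U').Reachable p q := by
    intro U' hU' hpU hqU
    have hru : ∀ z ∈ U', L (k + 1) z → (G.edgesWithin U').Reachable u z := by
      intro z hzU hz
      obtain ⟨w, hzw, hw⟩ := hL.exists_pred k z hz
      refine (hL.reachable k (fun m hm v hv ↦ hU' ⟨m, hm, hv⟩) w hw).trans (Adj.reachable ?_)
      exact ⟨hzw.symm, hU' ⟨k, le_rfl, hw⟩, hzU⟩
    exact (hru p hpU hp).symm.trans (hru q hqU hq)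
  by_cases haq : G.Adj a q
  · by_cases hcom : ∃ r ∈ U, G.Adj p r ∧ G.Adj q r
    · obtain ⟨r, ⟨m, hm, hr⟩, hpr, hqr⟩ := hcom
      exact hD ⟨a, x, b, q, r, p, hxa.symm, hxb, hbq, hqr, hpr.symm, hap.symm, haq,
        hL.not_adj hx hr (by omega) (by omega), hbp⟩
    -- Without a common neighbour further down, `p` and `q` are joined through `U` by an induced
    -- path that `a` closes to a hole.
    · refine hH (hasHole_of_reachable (U := insert p (insert q U)) hpq
        (hL.not_adj hp hq (by omega) (by omega)) hap haq (by simp) ?_ ?_ ?_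
        (hr _ (fun v hv ↦ by simp [hv]) (by simp) (by simp)))
      · rintro (rfl | rfl | haU)
        · exact G.loopless.irrefl _ hap
        · exact G.loopless.irrefl _ haq
        · have := hUn _ haU _ ha
          omega
      · rintro y (rfl | rfl | ⟨m, hm, hy⟩) hay
        · exact Or.inl rfl
        · exact Or.inr rfl
        · exact absurd hay (hL.not_adj ha hy (by omega) (by omega))
      · rintro y (rfl | rfl | hy) hpy hqy
        · exact G.loopless.irrefl _ hpy
        · exact G.loopless.irrefl _ hqy
        · exact hcom ⟨y, hy, hpy, hqy⟩
  -- Now `a` and `b` have no common neighbour among `p`, `q` and the lower levels, so a path through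
  -- these is closed to a hole by `x`.
  · refine hH (hasHole_of_reachable (U := insert a (insert b (insert p (insert q U)))) hab
      (hL.not_adj ha hb (by omega) (by omega)) hxa hxb (by simp) ?_ ?_ ?_ ?_)
    · rintro (rfl | rfl | rfl | rfl | hxU)
      · exact G.loopless.irrefl _ hxa
      · exact G.loopless.irrefl _ hxb
      · have := hL.unique _ _ _ hx hp
        omega
      · have := hL.unique _ _ _ hx hq
        omega
      · have := hUn _ hxU _ hx
        omega
    · rintro y (rfl | rfl | rfl | rfl | ⟨m, hm, hy⟩) hxy
      · exact Or.inl rfl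
      · exact Or.inr rfl
      · exact absurd hxy (hL.not_adj hx hp (by omega) (by omega))
      · exact absurd hxy (hL.not_adj hx hq (by omega) (by omega))
      · exact absurd hxy (hL.not_adj hx hy (by omega) (by omega))
    · rintro y (rfl | rfl | rfl | rfl | ⟨m, hm, hy⟩) hay hby
      · exact G.loopless.irrefl _ hay
      · exact G.loopless.irrefl _ hby
      · exact hbp hby
      · exact haq hay
      · exact hL.not_adj ha hy (by omega) (by omega) hay
    · refine Reachable.trans (v := p) (Adj.reachable ?_)
        ((hr _ (fun v hv ↦ by simp [hv]) (by simp) (by simp)).trans (Adj.reachable ?_))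
      · exact ⟨hap, by simp, by simp⟩
      · exact ⟨hbq.symm, by simp, by simp⟩

/-- The neighbourhoods of two vertices of a level in the previous level are comparable or
disjoint. -/
lemma adj_or_adj (hL : G.IsLevelStructure u L) (hH : ¬ G.HasHole) (hD : ¬ G.HasDomino) {k : ℕ}
    {x y a b c : α} (hx : L (k + 1) x) (hy : L (k + 1) y) (ha : L k a) (hb : L k b) (hc : L k c)
    (hxc : G.Adj x c) (hyc : G.Adj y c) (hxa : G.Adj x a) (hyb : G.Adj y b) :
    G.Adj y a ∨ G.Adj x b := by
  by_contra! hcon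
  obtain _ | k := k
  · rw [(hL.zero_iff _).1 ha, ← (hL.zero_iff _).1 hc] at hcon
    exact hcon.1 hyc
  obtain ⟨p, hcp, hp⟩ := hL.exists_pred k c hc
  -- A neighbour `p` of `c` one level down is shared by `a` and `b`, and it completes a domino with
  -- chord `p c`.
  have hap := hL.adj_of_adj hH hD hx hc ha hp hxc hxa hcp
  have hbp := hL.adj_of_adj hH hD hy hc hb hp hyc hyb hcp
  exact hD ⟨p, a, x, c, y, b, hap.symm, hxa.symm, hxc, hyc.symm, hyb, hbp, hcp.symm,
    fun h ↦ hcon.1 h.symm, hcon.2⟩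

/-- Take a vertex `x` of minimum degree in the last level. If it is not pendant, any two of its
neighbours are twins: `adj_of_adj` handles the level below them, and minimality of the degree
handles the last level. -/
lemma exists_pendant_or_twins (hL : G.IsLevelStructure u L) (hH : ¬ G.HasHole)
    (hD : ¬ G.HasDomino) (hfin : G.support.Finite) {k : ℕ} {z : α} (hz : L (k + 1) z)
    (hmax : ∀ n v, L n v → n ≤ k + 1) :
    ∃ e f, e ≠ f ∧ ((∃ g, G.Adj e g ∧ G.Adj f g) ∧ (∀ g, G.Adj e g ↔ G.Adj f g) ∨
      ∀ g, G.Adj e g ↔ g = f) := by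
  have hnbr : ∀ x y, L (k + 1) x → G.Adj x y → L k y := by
    intro x y hx hxy
    obtain h | ⟨m, hm, h⟩ := hL.adj _ x y hx hxy
    · have := hmax _ _ h
      omega
    · rwa [Nat.succ_injective hm]
  have hsupp : ∀ x, L (k + 1) x → x ∈ G.support := fun x hx ↦
    let ⟨w, hw, _⟩ := hL.exists_pred k x hx; ⟨w, hw⟩
  obtain ⟨x, hx, hmin⟩ := Set.exists_min_image {x | L (k + 1) x} (fun x ↦ (G.neighborSet x).ncard)
    (hfin.subset hsupp) ⟨z, hz⟩
  obtain ⟨f, hxf, -⟩ := hL.exists_pred k x hx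
  by_cases hpend : ∀ g, G.Adj x g → g = f
  · exact ⟨x, f, hxf.ne, Or.inr fun g ↦ ⟨hpend g, fun h ↦ h ▸ hxf⟩⟩
  · push Not at hpend
    obtain ⟨g, hxg, hgf⟩ := hpend
    have key : ∀ a b, G.Adj x a → G.Adj x b → ∀ p, G.Adj a p → G.Adj b p := by
      intro a b hxa hxb p hap
      have ha := hnbr x a hx hxa
      have hb := hnbr x b hx hxb
      obtain hp | ⟨m, rfl, hp⟩ := hL.adj _ a p ha hap
      · by_contra hbp
        -- By `adj_or_adj`, a vertex `p` of the last level adjacent to `a` but not to `b` has all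
        -- its neighbours among those of `x`, and it misses `b`; its degree would be smaller.
        have hss : G.neighborSet p ⊂ G.neighborSet x := by
          rw [ssubset_iff_of_subset fun c hc ↦ ?_]
          · exact ⟨b, hxb, fun h ↦ hbp (G.adj_symm h)⟩
          · obtain h | h := hL.adj_or_adj hH hD hx hp hb (hnbr p c hp hc) ha hxa hap.symm hxb hc
            · exact absurd h.symm hbp
            · exact h
        refine (hmin p hp).not_gt (ncard_lt_ncard hss (hfin.subset fun c hc ↦ ⟨x, G.adj_symm hc⟩))
      · exact hL.adj_of_adj hH hD hx ha hb hp hxa hxb hap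
    exact ⟨g, f, hgf, Or.inl ⟨⟨x, hxg.symm, hxf.symm⟩,
      fun p ↦ ⟨key g f hxg hxf p, key f g hxf hxg p⟩⟩⟩

end IsLevelStructure

/-- A finite bipartite graph with an edge and without long induced cycles and dominoes has a
pendant vertex or a pair of twins. -/
theorem exists_pendant_or_twins {s : Set α} (hs : ∀ a b, G.Adj a b → (a ∈ s ↔ b ∉ s))
    (hfin : G.support.Finite) {u u' : α} (hu : G.Adj u u') (hH : ¬ G.HasHole)
    (hD : ¬ G.HasDomino) :
    ∃ e f, e ≠ f ∧ ((∃ g, G.Adj e g ∧ G.Adj f g) ∧ (∀ g, G.Adj e g ↔ G.Adj f g) ∨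
      ∀ g, G.Adj e g ↔ g = f) := by
  have hL := isLevelStructure_dist hs u
  have hsupp : ∀ n v, G.Reachable u v ∧ G.dist u v = n → v ∈ G.support := by
    rintro n v hv
    cases n with
    | zero => rw [(hL.zero_iff v).1 hv]; exact ⟨u', hu⟩
    | succ n =>
      obtain ⟨w, hw, -⟩ := hL.exists_pred n v hv
      exact ⟨w, hw⟩
  have hdist : ∀ v, G.Reachable u v → G.Reachable u v ∧ G.dist u v = G.dist u v :=
    fun v hv ↦ ⟨hv, rfl⟩
  obtain ⟨z, hz, hmax⟩ := Set.exists_max_image {v | G.Reachable u v} (G.dist u)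
    (hfin.subset fun v hv ↦ hsupp _ v (hdist v hv)) ⟨u, .refl _⟩
  have hk0 : G.dist u z ≠ 0 := by
    have h1 := hmax u' hu.reachable
    rw [dist_eq_one_iff_adj.2 hu] at h1
    omega
  obtain ⟨k, hk⟩ := Nat.exists_eq_succ_of_ne_zero hk0
  refine hL.exists_pendant_or_twins (k := k) (z := z) hH hD hfin ?_ ?_
  · exact ⟨hz, hk⟩
  rintro n v ⟨hv, rfl⟩
  exact (hmax v hv).trans_eq hk

end SimpleGraph

end

section
open Set Submodule

/-! ### `M(K₄)`-minors from induced cycles and dominoes. -/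

namespace Matroid
open SimpleGraph

section Certificates

variable {α V : Type*} [AddCommGroup V] [Module (ZMod 2) V] {M : Matroid α} {v : α → V}

/-- Six elements which form an `M(K₄)` modulo a set `C` yield an `M(K₄)`-minor. -/
lemma Represents.hasMK4Minor_of_mem_span (h : Represents v M) {C : Set α} (hC : C ⊆ M.E)
    {a b c d e f : α} (hE : {a, b, c, d, e, f} ⊆ M.E)
    (hd : v d + (v a + v b) ∈ span (ZMod 2) (v '' C))
    (he : v e + (v b + v c) ∈ span (ZMod 2) (v '' C))
    (hf : v f + (v a + v c) ∈ span (ZMod 2) (v '' C))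
    (hfun : ∀ x y z : ZMod 2, ∃ F : V →ₗ[ZMod 2] ZMod 2,
      (∀ u ∈ C, F (v u) = 0) ∧ F (v a) = x ∧ F (v b) = y ∧ F (v c) = z) :
    M.HasMK4Minor := by
  simp only [insert_subset_iff, singleton_subset_iff] at hE
  obtain ⟨ha', hb', hc', hd', he', hf'⟩ := hE
  -- The vertices of `K₄` carry the vectors `0`, `v a`, `v b`, `v c`, and entry `i j` is the element
  -- on the edge `ij`. The diagonal is filled arbitrarily.
  let A : Fin 4 → Fin 4 → α := ![![a, a, b, c], ![a, a, d, f], ![b, d, a, e], ![c, f, e, a]]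
  have hA : ∀ i j, A i j = A j i := by
    intro i j
    fin_cases i <;> fin_cases j <;> rfl
  have hself : ∀ x : V, x + x ∈ span (ZMod 2) (v '' C) := fun x ↦ by
    rw [ZModModule.add_self]; exact zero_mem _
  refine h.hasMK4Minor C hC (Sym2.lift ⟨A, hA⟩) ?_ ![0, v a, v b, v c] ?_ ?_
  · intro i j hij
    change A i j ∈ M.E
    fin_cases i <;> fin_cases j <;> assumption
  · intro i j hij
    change v (A i j) + _ ∈ _
    fin_cases i <;> fin_cases j <;> first | exact absurd rfl hij | skip
    all_goals simp [A]
    all_goals first | exact hself _ | assumption | (rw [add_comm (v _) (v a)]; assumption) |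
      (rw [add_comm (v c) (v b)]; assumption)
  · intro χ
    obtain ⟨F, hFC, hFa, hFb, hFc⟩ := hfun (χ 1 + χ 0) (χ 2 + χ 0) (χ 3 + χ 0)
    refine ⟨F, χ 0, hFC, fun i ↦ ?_⟩
    fin_cases i
    · simp [ZModModule.add_self]
    · exact hFa
    · exact hFb
    · exact hFc

end Certificates

variable {α : Type*} {M : Matroid α} {v : α → α →₀ ZMod 2} {B : Set α}

/-- `v` represents `M`, in standard form with respect to the base `B`. -/
structure IsStandard (v : α → α →₀ ZMod 2) (M : Matroid α) (B : Set α) : Prop where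
  represents : Represents v M
  isBase : M.IsBase B
  apply_base : ∀ b ∈ B, v b = Finsupp.single b 1
  apply_eq_zero : ∀ e ∈ M.E, ∀ b ∉ B, v e b = 0

namespace IsStandard

lemma span_image (h : IsStandard v M B) {S : Set α} (hS : S ⊆ B) :
    span (ZMod 2) (v '' S) = Finsupp.supported (ZMod 2) (ZMod 2) S := by
  rw [Finsupp.supported_eq_span_single]
  exact congrArg _ (image_congr fun b hb ↦ h.apply_base b (hS hb))

/-- Modulo the elements of `B` outside of `S`, the vector of an element is determined by its
coordinates in `S`. -/
lemma add_mem_span (h : IsStandard v M B) {S : Set α} {e : α} (he : e ∈ M.E)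
    {t : α →₀ ZMod 2} (ht : t ∈ Finsupp.supported (ZMod 2) (ZMod 2) S)
    (het : ∀ b ∈ S, v e b = t b) : v e + t ∈ span (ZMod 2) (v '' (B \ S)) := by
  rw [h.span_image sdiff_subset, Finsupp.mem_supported']
  intro b hb
  rw [Finsupp.add_apply]
  by_cases hbS : b ∈ S
  · rw [het b hbS, ZModModule.add_self]
  · rw [h.apply_eq_zero e he b fun hbB ↦ hb ⟨hbB, hbS⟩, (Finsupp.mem_supported' _ _).1 ht b hbS,
      add_zero]

/-- A functional supported on `S` kills the base elements outside `S`, so it can be evaluated modulo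
their span. -/
lemma linearCombination_eq (h : IsStandard v M B) {S : Set α} {x t : α →₀ ZMod 2}
    (hx : x + t ∈ span (ZMod 2) (v '' (B \ S))) {φ : α → ZMod 2} (hφ : ∀ b ∉ S, φ b = 0) :
    Finsupp.linearCombination (ZMod 2) φ x = Finsupp.linearCombination (ZMod 2) φ t := by
  have hle : span (ZMod 2) (v '' (B \ S)) ≤ LinearMap.ker (Finsupp.linearCombination (ZMod 2) φ) := by
    rw [span_le]
    rintro _ ⟨b, hb, rfl⟩
    rw [SetLike.mem_coe, LinearMap.mem_ker, h.apply_base b hb.1, Finsupp.linearCombination_single,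
      hφ b hb.2, smul_zero]
  have h0 := LinearMap.mem_ker.1 (hle hx)
  rw [map_add, add_eq_zero_iff_eq_neg] at h0
  rw [h0, ZModModule.neg_eq_self]

/-- A cycle of length at least six in the fundamental graph which is induced yields an
`M(K₄)`-minor. -/
lemma hasMK4Minor_of_cycle (h : IsStandard v M B) {m : ℕ} (hm : 2 ≤ m) {r c : ℕ → α} {x : α}
    (hr : ∀ i ≤ m, r i ∈ B) (hinj : InjOn r (Iic m)) (hc : ∀ j < m, c j ∈ M.E) (hx : x ∈ M.E)
    (hcr : ∀ j < m, ∀ i ≤ m, v (c j) (r i) = if i = j ∨ i = j + 1 then 1 else 0)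
    (hxr : ∀ i ≤ m, v x (r i) = if i = 0 ∨ i = m then 1 else 0) : M.HasMK4Minor := by
  classical
  let S := r '' Iic m
  have hBE := h.isBase.subset_ground
  have hsupp : ∀ i ≤ m, ∀ j ≤ m,
      Finsupp.single (r i) (1 : ZMod 2) + Finsupp.single (r j) 1 ∈
        Finsupp.supported (ZMod 2) (ZMod 2) S := fun i hi j hj ↦
    add_mem (Finsupp.single_mem_supported _ _ ⟨i, hi, rfl⟩)
      (Finsupp.single_mem_supported _ _ ⟨j, hj, rfl⟩)
  have hval : ∀ i ≤ m, ∀ j ≤ m, i ≠ j → ∀ l ≤ m,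
      (Finsupp.single (r i) (1 : ZMod 2) + Finsupp.single (r j) 1 : α →₀ ZMod 2) (r l) =
        if l = i ∨ l = j then 1 else 0 := by
    intro i hi j hj hij l hl
    have h1 : r i = r l ↔ l = i := ⟨fun h ↦ (hinj hi hl h).symm, fun h ↦ h ▸ rfl⟩
    have h2 : r j = r l ↔ l = j := ⟨fun h ↦ (hinj hj hl h).symm, fun h ↦ h ▸ rfl⟩
    rw [Finsupp.add_apply, Finsupp.single_apply, Finsupp.single_apply]
    simp only [h1, h2]
    split_ifs <;> first | rfl | omega
  have hcU : ∀ j < m, v (c j) + (Finsupp.single (r j) 1 + Finsupp.single (r (j + 1)) 1) ∈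
      span (ZMod 2) (v '' (B \ S)) := by
    intro j hj
    refine h.add_mem_span (hc j hj) (hsupp j hj.le (j + 1) hj) ?_
    rintro _ ⟨i, hi, rfl⟩
    rw [hcr j hj i hi, hval j hj.le (j + 1) hj (by omega) i hi]
  have hxU : v x + (Finsupp.single (r 0) 1 + Finsupp.single (r m) 1) ∈
      span (ZMod 2) (v '' (B \ S)) := by
    refine h.add_mem_span hx (hsupp 0 (by omega) m le_rfl) ?_
    rintro _ ⟨i, hi, rfl⟩
    rw [hxr i hi, hval 0 (by omega) m le_rfl (by omega) i hi]
  -- Modulo `B \ S`, the `c j` and `x` are the edges of a polygon on the `r i`. Contracting `c j`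
  -- for `2 ≤ j < m` merges `r 2, …, r m` and leaves a triangle with its three vertex vectors, which
  -- is `M(K₄)`.
  let C := B \ S ∪ c '' {j | 2 ≤ j ∧ j < m}
  have hle : span (ZMod 2) (v '' (B \ S)) ≤ span (ZMod 2) (v '' C) :=
    span_mono (image_mono subset_union_left)
  have hcontr : ∀ j, 2 ≤ j → j ≤ m → Finsupp.single (r j) 1 + Finsupp.single (r 2) 1 ∈
      span (ZMod 2) (v '' C) := by
    intro j hj
    induction j, hj using Nat.le_induction with
    | base =>
      intro _
      rw [ZModModule.add_self]
      exact zero_mem _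
    | succ j hj ih =>
      intro hjm
      have h1 : v (c j) ∈ span (ZMod 2) (v '' C) :=
        subset_span ⟨_, Or.inr ⟨j, ⟨hj, hjm⟩, rfl⟩, rfl⟩
      have h2 := sub_mem (add_mem (ih (by omega)) (hle (hcU j hjm))) h1
      have h3 := ZModModule.add_self (Finsupp.single (r j) (1 : ZMod 2))
      convert h2 using 1
      linear_combination (norm := module) - h3
  have hrv : ∀ i ≤ m, v (r i) = Finsupp.single (r i) 1 := fun i hi ↦ h.apply_base _ (hr i hi)
  refine h.represents.hasMK4Minor_of_mem_span (C := C) (a := r 0) (b := r 1) (c := r 2) (d := c 0)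
    (e := c 1) (f := x) ?_ ?_ ?_ ?_ ?_ ?_
  · rintro _ (he | ⟨j, hj, rfl⟩)
    exacts [hBE he.1, hc j hj.2]
  · simp only [insert_subset_iff, singleton_subset_iff]
    exact ⟨hBE (hr 0 (by omega)), hBE (hr 1 (by omega)), hBE (hr 2 hm), hc 0 (by omega),
      hc 1 (by omega), hx⟩
  · rw [hrv 0 (by omega), hrv 1 (by omega)]
    exact hle (hcU 0 (by omega))
  · rw [hrv 1 (by omega), hrv 2 (by omega)]
    exact hle (hcU 1 (by omega))
  · rw [hrv 0 (by omega), hrv 2 (by omega)]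
    have h1 := add_mem (hle hxU) (hcontr m hm le_rfl)
    have h3 := ZModModule.add_self (Finsupp.single (r m) (1 : ZMod 2))
    convert h1 using 1
    linear_combination (norm := module) - h3
  · intro y₀ y₁ y₂
    -- Constant from index two on, so that the functional vanishes on the contracted `c j`.
    let ψ : ℕ → ZMod 2 := fun i ↦ if i = 0 then y₀ else if i = 1 then y₁ else y₂
    obtain ⟨φ, hφ, hφ0⟩ : ∃ φ : α → ZMod 2, (∀ i ≤ m, φ (r i) = ψ i) ∧ ∀ b ∉ S, φ b = 0 := by
      refine ⟨fun b ↦ if b ∈ S then ψ (Function.invFunOn r (Iic m) b) else 0, fun i hi ↦ ?_,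
        fun b hb ↦ if_neg hb⟩
      have : r i ∈ S := ⟨i, hi, rfl⟩
      simp only [this, if_true]
      rw [hinj.leftInvOn_invFunOn hi]
    have hφr : ∀ i ≤ m, Finsupp.linearCombination (ZMod 2) φ (Finsupp.single (r i) 1) = ψ i := by
      intro i hi
      rw [Finsupp.linearCombination_single, one_smul, hφ i hi]
    refine ⟨Finsupp.linearCombination (ZMod 2) φ, ?_, ?_, ?_, ?_⟩
    · rintro _ (he | ⟨j, hj, rfl⟩)
      · rw [h.apply_base _ he.1, Finsupp.linearCombination_single, hφ0 _ he.2, smul_zero]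
      · have h1 := hj.1
        have h2 := hj.2
        rw [h.linearCombination_eq (hcU j h2) hφ0, map_add, hφr j h2.le, hφr (j + 1) h2]
        have h3 : ψ j = y₂ := by simp only [ψ]; rw [if_neg (by omega), if_neg (by omega)]
        have h4 : ψ (j + 1) = y₂ := by simp only [ψ]; rw [if_neg (by omega), if_neg (by omega)]
        rw [h3, h4, ZModModule.add_self]
    · rw [hrv 0 (by omega), hφr 0 (by omega)]; rfl
    · rw [hrv 1 (by omega), hφr 1 (by omega)]; rfl
    · rw [hrv 2 hm, hφr 2 hm]; rfl

/-- An induced domino in the fundamental graph yields an `M(K₄)`-minor. -/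
lemma hasMK4Minor_of_domino (h : IsStandard v M B) {b₁ b₂ b₃ x₁ x₂ x₃ : α} (h1 : b₁ ∈ B)
    (h2 : b₂ ∈ B) (h3 : b₃ ∈ B) (h12 : b₁ ≠ b₂) (h13 : b₁ ≠ b₃) (h23 : b₂ ≠ b₃) (hx1 : x₁ ∈ M.E)
    (hx2 : x₂ ∈ M.E) (hx3 : x₃ ∈ M.E) (h11 : v x₁ b₁ = 1) (h12' : v x₁ b₂ = 1)
    (h13' : v x₁ b₃ = 0) (h21 : v x₂ b₁ = 0) (h22 : v x₂ b₂ = 1) (h23' : v x₂ b₃ = 1)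
    (h31 : v x₃ b₁ = 1) (h32 : v x₃ b₂ = 1) (h33 : v x₃ b₃ = 1) : M.HasMK4Minor := by
  classical
  let S : Set α := {b₁, b₂, b₃}
  have hBE := h.isBase.subset_ground
  have hs1 := Finsupp.single_mem_supported (ZMod 2) (1 : ZMod 2) (show b₁ ∈ S by simp [S])
  have hs2 := Finsupp.single_mem_supported (ZMod 2) (1 : ZMod 2) (show b₂ ∈ S by simp [S])
  have hs3 := Finsupp.single_mem_supported (ZMod 2) (1 : ZMod 2) (show b₃ ∈ S by simp [S])
  have hU1 : v x₁ + (Finsupp.single b₁ 1 + Finsupp.single b₂ 1) ∈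
      span (ZMod 2) (v '' (B \ S)) := by
    refine h.add_mem_span hx1 (add_mem hs1 hs2) ?_
    rintro b (rfl | rfl | rfl) <;> simp [*, h12.symm]
  have hU2 : v x₂ + (Finsupp.single b₂ 1 + Finsupp.single b₃ 1) ∈
      span (ZMod 2) (v '' (B \ S)) := by
    refine h.add_mem_span hx2 (add_mem hs2 hs3) ?_
    rintro b (rfl | rfl | rfl) <;>
      simp [*, h23.symm]
  have hU3 : v x₃ + (Finsupp.single b₁ 1 + Finsupp.single b₂ 1 + Finsupp.single b₃ 1) ∈
      span (ZMod 2) (v '' (B \ S)) := by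
    refine h.add_mem_span hx3 (add_mem (add_mem hs1 hs2) hs3) ?_
    rintro b (rfl | rfl | rfl) <;>
      simp [*, h12.symm, h13.symm, h23.symm]
  have e2 := ZModModule.add_self (Finsupp.single b₂ (1 : ZMod 2))
  have e3 := ZModModule.add_self (Finsupp.single b₃ (1 : ZMod 2))
  -- Modulo `B \ S` the six elements are the points of the Fano plane other than `b₁ + b₃`. With `x₂
  -- = b₂ + b₃` as third basis vector, `x₁`, `b₃` and `x₃` become the pairwise sums.
  refine h.represents.hasMK4Minor_of_mem_span (C := B \ S) (a := b₁) (b := b₂) (c := x₂) (d := x₁)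
    (e := b₃) (f := x₃) (sdiff_subset.trans hBE) ?_ ?_ ?_ ?_ ?_
  · simp [insert_subset_iff, hBE h1, hBE h2, hBE h3, hx1, hx2, hx3]
  · rwa [h.apply_base _ h1, h.apply_base _ h2]
  · rw [h.apply_base _ h2, h.apply_base _ h3]
    convert hU2 using 1
    module
  · rw [h.apply_base _ h1]
    convert add_mem hU3 hU2 using 1
    linear_combination (norm := module) - e2 - e3
  · intro y₁ y₂ y₃
    let φ : α → ZMod 2 := fun b ↦
      if b = b₁ then y₁ else if b = b₂ then y₂ else if b = b₃ then y₂ + y₃ else 0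
    have hφ0 : ∀ b ∉ S, φ b = 0 := by
      intro b hb
      simp only [S, mem_insert_iff, mem_singleton_iff, not_or] at hb
      simp [φ, hb]
    have hφ1 : φ b₁ = y₁ := if_pos rfl
    have hφ2 : φ b₂ = y₂ := by simp [φ, h12.symm]
    have hφ3 : φ b₃ = y₂ + y₃ := by simp [φ, h13.symm, h23.symm]
    refine ⟨Finsupp.linearCombination (ZMod 2) φ, fun b hb ↦ ?_, ?_, ?_, ?_⟩
    · rw [h.apply_base _ hb.1, Finsupp.linearCombination_single, hφ0 _ hb.2, smul_zero]
    · rw [h.apply_base _ h1, Finsupp.linearCombination_single, one_smul, hφ1]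
    · rw [h.apply_base _ h2, Finsupp.linearCombination_single, one_smul, hφ2]
    · rw [h.linearCombination_eq hU2 hφ0, map_add, Finsupp.linearCombination_single,
        Finsupp.linearCombination_single, one_smul, one_smul, hφ2, hφ3, ← add_assoc,
        ZModModule.add_self, zero_add]

end IsStandard

end Matroid

end

section
open Set

/-! ### The fundamental graph and its clones. -/

namespace Matroid
open SimpleGraph

variable {α : Type*} {M : Matroid α} {v : α → α →₀ ZMod 2} {B : Set α}

/-- The fundamental graph: an element `b` of `B` and an element `e` outside of `B` are adjacent if
`b` lies in the fundamental circuit of `e`. -/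
def fundGraph (v : α → α →₀ ZMod 2) (M : Matroid α) (B : Set α) : SimpleGraph α where
  Adj b e := (b ∈ B ∧ e ∈ M.E \ B ∧ v e b = 1) ∨ (e ∈ B ∧ b ∈ M.E \ B ∧ v b e = 1)
  symm := ⟨fun _ _ h ↦ h.symm⟩
  loopless := ⟨fun _ h ↦ h.elim (fun h ↦ h.2.1.2 h.1) fun h ↦ h.2.1.2 h.1⟩

lemma fundGraph_adj_mem_iff {a b : α} (h : (fundGraph v M B).Adj a b) : a ∈ B ↔ b ∉ B := by
  obtain ⟨h1, h2, -⟩ | ⟨h1, h2, -⟩ := h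
  · exact iff_of_true h1 h2.2
  · exact iff_of_false h2.2 (not_not.2 h1)

lemma apply_eq_one_iff_adj {b e : α} (hb : b ∈ B) (heE : e ∈ M.E) (he : e ∉ B) :
    v e b = 1 ↔ (fundGraph v M B).Adj b e := by
  simp only [fundGraph, mem_sdiff]
  tauto

lemma eq_ite_of_iff {x : ZMod 2} {p : Prop} [Decidable p] (h : x = 1 ↔ p) :
    x = if p then 1 else 0 := by
  have : ∀ x : ZMod 2, x = 0 ∨ x = 1 := by decide
  split_ifs with hp
  · exact h.2 hp
  · exact (this x).resolve_right fun hx ↦ hp (h.1 hx)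

lemma apply_eq_of_adj_iff {b b' e e' : α} (hb : b ∈ B) (hb' : b' ∈ B)
    (he : e ∈ M.E \ B) (he' : e' ∈ M.E \ B)
    (hiff : (fundGraph v M B).Adj b e ↔ (fundGraph v M B).Adj b' e') : v e b = v e' b' := by
  classical
  rw [eq_ite_of_iff (apply_eq_one_iff_adj hb he.1 he.2), eq_ite_of_iff
    (apply_eq_one_iff_adj hb' he'.1 he'.2)]
  simp only [hiff]

namespace IsStandard

lemma mem_ground_of_adj (h : IsStandard v M B) {a b : α} (hab : (fundGraph v M B).Adj a b) :
    a ∈ M.E := by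
  obtain ⟨h1, -⟩ | ⟨-, h2, -⟩ := hab
  exacts [h.isBase.subset_ground h1, h2.1]

lemma hasMK4Minor_of_hasDomino (h : IsStandard v M B) (hD : (fundGraph v M B).HasDomino) :
    M.HasMK4Minor := by
  have main : ∀ v₀ v₁ v₂ v₃ v₄ v₅, v₀ ∈ B → (fundGraph v M B).Adj v₀ v₁ →
      (fundGraph v M B).Adj v₁ v₂ → (fundGraph v M B).Adj v₂ v₃ → (fundGraph v M B).Adj v₃ v₄ →
      (fundGraph v M B).Adj v₄ v₅ → (fundGraph v M B).Adj v₅ v₀ → (fundGraph v M B).Adj v₀ v₃ →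
      ¬ (fundGraph v M B).Adj v₁ v₄ → ¬ (fundGraph v M B).Adj v₂ v₅ → M.HasMK4Minor := by
    intro v₀ v₁ v₂ v₃ v₄ v₅ m0 a01 a12 a23 a34 a45 a50 a03 n14 n25
    have m1 := (fundGraph_adj_mem_iff a01).1 m0
    have m2 := (fundGraph_adj_mem_iff a12.symm).2 m1
    have m3 := (fundGraph_adj_mem_iff a03).1 m0
    have m4 := (fundGraph_adj_mem_iff a34.symm).2 m3
    have m5 := (fundGraph_adj_mem_iff a50.symm).1 m0
    have e1 := h.mem_ground_of_adj a12
    have e3 := h.mem_ground_of_adj a34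
    have e5 := h.mem_ground_of_adj a50
    have hz : ∀ x : ZMod 2, x ≠ 1 → x = 0 := by decide
    refine h.hasMK4Minor_of_domino (b₁ := v₂) (b₂ := v₀) (b₃ := v₄) (x₁ := v₁) (x₂ := v₅) (x₃ := v₃)
      m2 m0 m4 ?_ ?_ ?_ e1 e5 e3 ?_ ?_ (hz _ ?_) (hz _ ?_) ?_ ?_ ?_ ?_ ?_
    · rintro rfl; exact n25 a50.symm
    · rintro rfl; exact n14 a12
    · rintro rfl; exact n14 a01.symm
    · exact (apply_eq_one_iff_adj m2 e1 m1).2 a12.symm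
    · exact (apply_eq_one_iff_adj m0 e1 m1).2 a01
    · exact fun h' ↦ n14 ((apply_eq_one_iff_adj m4 e1 m1).1 h').symm
    · exact fun h' ↦ n25 ((apply_eq_one_iff_adj m2 e5 m5).1 h')
    · exact (apply_eq_one_iff_adj m0 e5 m5).2 a50.symm
    · exact (apply_eq_one_iff_adj m4 e5 m5).2 a45
    · exact (apply_eq_one_iff_adj m2 e3 m3).2 a23
    · exact (apply_eq_one_iff_adj m0 e3 m3).2 a03
    · exact (apply_eq_one_iff_adj m4 e3 m3).2 a34.symm
  obtain ⟨v₀, v₁, v₂, v₃, v₄, v₅, a01, a12, a23, a34, a45, a50, a03, n14, n25⟩ := hD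
  by_cases m0 : v₀ ∈ B
  · exact main v₀ v₁ v₂ v₃ v₄ v₅ m0 a01 a12 a23 a34 a45 a50 a03 n14 n25
  -- Half a turn of the closed walk exchanges the ends of the chord, and with them the two sides.
  · have m3 := (fundGraph_adj_mem_iff a03.symm).2 m0
    exact main v₃ v₄ v₅ v₀ v₁ v₂ m3 a34 a45 a50 a01 a12 a23 a03.symm (fun h ↦ n14 h.symm)
      fun h ↦ n25 h.symm

lemma hasMK4Minor_of_hasHole (h : IsStandard v M B) (hH : (fundGraph v M B).HasHole) :
    M.HasMK4Minor := by
  obtain ⟨x, w, D, hD, hinj, hwx, hw, hx⟩ := hH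
  have hadj : ∀ i < D, (fundGraph v M B).Adj (w i) (w (i + 1)) :=
    fun i hi ↦ (hw i hi.le (i + 1) hi).2 (Or.inl rfl)
  have hx0 : (fundGraph v M B).Adj x (w 0) := (hx 0 (by omega)).2 (Or.inl rfl)
  have hxD : (fundGraph v M B).Adj x (w D) := (hx D le_rfl).2 (Or.inr rfl)
  have hwE : ∀ i ≤ D, w i ∈ M.E := by
    intro i hi
    obtain hi | rfl := hi.lt_or_eq
    · exact h.mem_ground_of_adj (hadj i hi)
    · exact h.mem_ground_of_adj hxD.symm
  have hpar : ∀ i ≤ D, (w i ∈ B ↔ (Even i ↔ x ∉ B)) := by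
    intro i
    induction i with
    | zero =>
      intro _
      have := fundGraph_adj_mem_iff hx0
      simp only [Even.zero, true_iff]
      tauto
    | succ i ih =>
      intro hi
      have h1 := ih (by omega)
      have h2 := fundGraph_adj_mem_iff (hadj i (by omega))
      rw [Nat.even_add_one]
      tauto
  -- Both ends of the path are adjacent to `x`, hence on the same side. With `3 ≤ D` this gives `D =
  -- 2 * m` and `2 ≤ m`.
  have hDeven : Even D := by
    have h1 := hpar D le_rfl
    have h2 := fundGraph_adj_mem_iff hxD
    tauto
  obtain ⟨m, rfl⟩ := hDeven.exists_two_nsmul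
  rw [smul_eq_mul] at *
  by_cases hxB : x ∈ B
  · have hrow : ∀ i < m, w (2 * i + 1) ∈ B := fun i hi ↦
      (hpar _ (by omega)).2 (iff_of_false (by simp) (not_not.2 hxB))
    have hcol : ∀ i ≤ m, w (2 * i) ∉ B := fun i hi hmem ↦
      ((hpar _ (by omega)).1 hmem).1 (by simp) hxB
    -- If `x` lies in `B`, the cycle is read starting from `x`: odd path vertices are the other
    -- rows, and the last path vertex `w (2 * m)` is the closing column.
    let r : ℕ → α := fun i ↦ if i = 0 then x else w (2 * i - 1)
    have hr : ∀ i ≤ m, r i ∈ B := by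
      intro i hi
      obtain _ | i := i
      · exact hxB
      · exact hrow i hi
    refine h.hasMK4Minor_of_cycle (m := m) (by omega) (r := r) (c := fun i ↦ w (2 * i))
      (x := w (2 * m)) hr ?_ (fun j hj ↦ hwE _ (by omega)) (hwE _ le_rfl) ?_ ?_
    · rintro (_ | i) hi (_ | j) hj hij
      · rfl
      · exact absurd hij.symm (hwx _ (by rw [mem_Iic] at hj; omega))
      · exact absurd hij (hwx _ (by rw [mem_Iic] at hi; omega))
      · rw [mem_Iic] at hi hj
        have := hinj (mem_Iic.2 (by omega)) (mem_Iic.2 (by omega)) hij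
        omega
    · intro j hj i hi
      refine eq_ite_of_iff ?_
      rw [apply_eq_one_iff_adj (hr i hi) (hwE _ (by omega)) (hcol j hj.le)]
      obtain _ | i := i
      · exact (hx _ (by omega)).trans (by omega)
      · exact (hw (2 * (i + 1) - 1) (by omega) _ (by omega)).trans (by omega)
    · intro i hi
      refine eq_ite_of_iff ?_
      rw [apply_eq_one_iff_adj (hr i hi) (hwE _ le_rfl) (hcol m le_rfl)]
      obtain _ | i := i
      · exact (hx _ (by omega)).trans (by omega)
      · exact (hw (2 * (i + 1) - 1) (by omega) _ (by omega)).trans (by omega)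
  · have hrow : ∀ i ≤ m, w (2 * i) ∈ B := fun i hi ↦
      (hpar _ (by omega)).2 (iff_of_true (by simp) hxB)
    have hcol : ∀ i < m, w (2 * i + 1) ∉ B := fun i hi hmem ↦ by
      have := ((hpar _ (by omega)).1 hmem).2 hxB
      simp at this
    refine h.hasMK4Minor_of_cycle (m := m) (by omega) (r := fun i ↦ w (2 * i))
      (c := fun i ↦ w (2 * i + 1)) (x := x) hrow ?_ (fun j hj ↦ hwE _ (by omega))
      (h.mem_ground_of_adj hx0) ?_ ?_
    · intro i hi j hj hij
      rw [mem_Iic] at hi hj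
      have := hinj (mem_Iic.2 (by omega)) (mem_Iic.2 (by omega)) hij
      omega
    · intro j hj i hi
      refine eq_ite_of_iff ?_
      rw [apply_eq_one_iff_adj (hrow i hi) (hwE _ (by omega)) (hcol j hj)]
      exact (hw _ (by omega) _ (by omega)).trans (by omega)
    · intro i hi
      refine eq_ite_of_iff ?_
      rw [apply_eq_one_iff_adj (hrow i hi) (h.mem_ground_of_adj hx0) hxB, adj_comm]
      exact (hx _ (by omega)).trans (by omega)

lemma areClones_of_apply_eq (h : IsStandard v M B) {e f : α} (he : e ∈ M.E) (hf : f ∈ M.E)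
    (hef : e ≠ f) (hv : v e = v f) : M.AreClones e f := by
  classical
  refine h.represents.areClones he hf hef LinearMap.id Function.injective_id fun x _ ↦ ?_
  rw [LinearMap.id_apply, Equiv.swap_apply_def]
  split_ifs with h1 h2
  · rw [h1, hv]
  · rw [h2, hv]
  · rfl

lemma areClones_of_forall_apply_eq (h : IsStandard v M B) {e f : α} (he : e ∈ B) (hf : f ∈ B)
    (hef : e ≠ f) (hv : ∀ x ∈ M.E \ B, v x e = v x f) : M.AreClones e f := by
  classical
  have hBE := h.isBase.subset_ground
  refine h.represents.areClones (hBE he) (hBE hf) hef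
    (Finsupp.domLCongr (R := ZMod 2) (M := ZMod 2) (Equiv.swap e f)).toLinearMap
    (LinearEquiv.injective _) fun x hx ↦ ?_
  rw [LinearEquiv.coe_coe, Finsupp.domLCongr_apply]
  by_cases hxB : x ∈ B
  · have hswap : Equiv.swap e f x ∈ B := by
      rw [Equiv.swap_apply_def]
      split_ifs
      exacts [hf, he, hxB]
    rw [h.apply_base x hxB, h.apply_base _ hswap]
    exact Finsupp.equivMapDomain_single _ _ _
  · rw [Equiv.swap_apply_of_ne_of_ne (by rintro rfl; exact hxB he) (by rintro rfl; exact hxB hf)]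
    ext b
    change v x ((Equiv.swap e f).symm b) = v x b
    rw [Equiv.symm_swap, Equiv.swap_apply_def]
    split_ifs with h1 h2
    · rw [h1, hv x ⟨hx, hxB⟩]
    · rw [h2, hv x ⟨hx, hxB⟩]
    · rfl

lemma areClones_of_apply_eq_zero (h : IsStandard v M B) {e f : α} (he : e ∈ B) (hf : f ∈ M.E \ B)
    (hfe : v f e = 1) (hv : ∀ x ∈ M.E \ B, x ≠ f → v x e = 0) : M.AreClones e f := by
  classical
  have hBE := h.isBase.subset_ground
  have hef : e ≠ f := by rintro rfl; exact hf.2 he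
  -- The transvection adding `v f + v e` to the vectors with nonzero `e`-coordinate. It is an
  -- involution since `v f + v e` has `e`-coordinate zero; it swaps `v e` and `v f` and fixes every
  -- other element, whose `e`-coordinate is zero.
  let T : (α →₀ ZMod 2) →ₗ[ZMod 2] (α →₀ ZMod 2) :=
    LinearMap.id + (Finsupp.lapply e).smulRight (v f + Finsupp.single e 1)
  have hT : ∀ z, T z = z + z e • (v f + Finsupp.single e 1) := fun z ↦ rfl
  have hTe : ∀ z, (T z) e = z e := by
    intro z
    rw [hT, Finsupp.add_apply, Finsupp.smul_apply, Finsupp.add_apply, hfe, Finsupp.single_eq_same,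
      ZModModule.add_self, smul_zero, add_zero]
  have hTT : ∀ z, T (T z) = z := by
    intro z
    rw [hT (T z), hTe, hT, add_assoc, ZModModule.add_self, add_zero]
  refine h.represents.areClones (hBE he) hf.1 hef T
    (Function.LeftInverse.injective hTT) fun x hx ↦ ?_
  rw [hT]
  by_cases hxe : x = e
  · subst hxe
    rw [Equiv.swap_apply_left, h.apply_base x he, Finsupp.single_eq_same, one_smul,
      add_left_comm, ZModModule.add_self, add_zero]
  by_cases hxf : x = f
  · subst hxf
    rw [Equiv.swap_apply_right, h.apply_base e he, hfe, one_smul, ← add_assoc, ZModModule.add_self,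
      zero_add]
  rw [Equiv.swap_apply_of_ne_of_ne hxe hxf]
  have : v x e = 0 := by
    by_cases hxB : x ∈ B
    · rw [h.apply_base x hxB, Finsupp.single_eq_of_ne (Ne.symm hxe)]
    · exact hv x ⟨hx, hxB⟩ hxf
  rw [this, zero_smul, add_zero]

/-- Twins of the fundamental graph are clones. -/
lemma areClones_of_twins (h : IsStandard v M B) {e f : α} (he : e ∈ M.E) (hf : f ∈ M.E)
    (hef : e ≠ f) (hB : e ∈ B ↔ f ∈ B)
    (hadj : ∀ g, (fundGraph v M B).Adj e g ↔ (fundGraph v M B).Adj f g) : M.AreClones e f := by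
  by_cases heB : e ∈ B
  · exact h.areClones_of_forall_apply_eq heB (hB.1 heB) hef fun x hx ↦
      apply_eq_of_adj_iff heB (hB.1 heB) hx hx (hadj x)
  · have hfB : f ∉ B := fun hfB ↦ heB (hB.2 hfB)
    refine h.areClones_of_apply_eq he hf hef ?_
    ext b
    by_cases hb : b ∈ B
    · refine apply_eq_of_adj_iff hb hb ⟨he, heB⟩ ⟨hf, hfB⟩ ?_
      rw [adj_comm, hadj b, adj_comm]
    · rw [h.apply_eq_zero e he b hb, h.apply_eq_zero f hf b hb]

/-- A pendant vertex of the fundamental graph and its neighbour are clones. -/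
lemma areClones_of_pendant (h : IsStandard v M B) {e f : α}
    (hadj : ∀ g, (fundGraph v M B).Adj e g ↔ g = f) : M.AreClones e f := by
  have hef := (hadj f).2 rfl
  have he := h.mem_ground_of_adj hef
  have hf := h.mem_ground_of_adj hef.symm
  have hz : ∀ x : ZMod 2, x ≠ 1 → x = 0 := by decide
  by_cases heB : e ∈ B
  · have hfB := (fundGraph_adj_mem_iff hef).1 heB
    refine h.areClones_of_apply_eq_zero heB ⟨hf, hfB⟩ ((apply_eq_one_iff_adj heB hf hfB).2 hef) ?_
    exact fun x hx hxf ↦ hz _ fun h1 ↦ hxf ((hadj x).1 ((apply_eq_one_iff_adj heB hx.1 hx.2).1 h1))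
  · have hfB := (fundGraph_adj_mem_iff hef.symm).2 heB
    refine h.areClones_of_apply_eq he hf hef.ne ?_
    rw [h.apply_base f hfB]
    ext b
    by_cases hbf : b = f
    · subst hbf
      rw [Finsupp.single_eq_same, (apply_eq_one_iff_adj hfB he heB).2 hef.symm]
    · rw [Finsupp.single_eq_of_ne hbf]
      by_cases hb : b ∈ B
      · exact hz _ fun h1 ↦ hbf ((hadj b).1 ((apply_eq_one_iff_adj hb he heB).1 h1).symm)
      · exact h.apply_eq_zero e he b hb

lemma isLoopPlusColoop (h : IsStandard v M B) {e f : α} (hE : M.E = {e, f}) (he : e ∉ B)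
    (hf : f ∈ B) (hef : ¬ (fundGraph v M B).Adj f e) : M.IsLoopPlusColoop := by
  have heE : e ∈ M.E := by simp [hE]
  have hloop : M.IsLoop e := by
    rw [← singleton_dep, dep_iff, h.represents]
    refine ⟨fun h' ↦ h'.2.ne_zero (mem_singleton e) ?_, by simpa using heE⟩
    ext b
    by_cases hb : b ∈ B
    · have hbf : b = f := by
        have : b ∈ M.E := h.isBase.subset_ground hb
        rw [hE] at this
        obtain rfl | hbf := this
        exacts [absurd hb he, hbf]
      have hz : ∀ x : ZMod 2, x ≠ 1 → x = 0 := by decide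
      exact hz _ fun h1 ↦ hef (hbf ▸ (apply_eq_one_iff_adj hb heE he).1 h1)
    · exact h.apply_eq_zero e heE b hb
  refine ⟨e, f, by rintro rfl; exact he hf, hE, hloop, isColoop_iff_forall_mem_isBase.2 ?_⟩
  intro B' hB'
  by_contra hfB'
  have hB'e : B' ⊆ ∅ := by
    intro b hb
    have : b ∈ M.E := hB'.subset_ground hb
    rw [hE] at this
    obtain rfl | rfl := this
    · exact hloop.notMem_of_indep hB'.indep hb
    · exact hfB' hb
  rw [subset_empty_iff.1 hB'e] at hB'
  have := hB'.eq_of_subset_isBase h.isBase (empty_subset _)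
  rw [← this] at hf
  exact hf

/-- A finite binary matroid without an `M(K₄)`-minor has a pair of clones, unless it has at most
one element or consists of a loop and a coloop. -/
lemma exists_areClones (h : IsStandard v M B) (hfin : M.Finite) (hK : ¬ M.HasMK4Minor)
    (h2 : 2 ≤ M.E.encard) (hlc : ¬ M.IsLoopPlusColoop) : ∃ e f, M.AreClones e f := by
  by_cases hedge : ∃ a b, (fundGraph v M B).Adj a b
  · obtain ⟨a, b, hab⟩ := hedge
    have hsupp : (fundGraph v M B).support ⊆ M.E := by
      rintro x ⟨y, hxy⟩
      exact h.mem_ground_of_adj hxy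
    obtain ⟨e, f, hef, ⟨⟨g, heg, hfg⟩, hadj⟩ | hadj⟩ := exists_pendant_or_twins (s := B)
      (fun _ _ h ↦ fundGraph_adj_mem_iff h) (hfin.ground_finite.subset hsupp) hab
      (fun hH ↦ hK (h.hasMK4Minor_of_hasHole hH)) (fun hD ↦ hK (h.hasMK4Minor_of_hasDomino hD))
    · refine ⟨e, f, h.areClones_of_twins (h.mem_ground_of_adj heg) (h.mem_ground_of_adj hfg) hef ?_
        hadj⟩
      rw [fundGraph_adj_mem_iff heg, fundGraph_adj_mem_iff hfg]
    · exact ⟨e, f, h.areClones_of_pendant hadj⟩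
  -- Without edges, any two elements on the same side of `B` are twins, so a matroid without clones
  -- has exactly one element on each side: a coloop in `B` and a loop outside.
  · push Not at hedge
    have htwins : ∀ e ∈ M.E, ∀ f ∈ M.E, e ≠ f → (e ∈ B ↔ f ∈ B) → ∃ e f, M.AreClones e f :=
      fun e he f hf hef hB ↦ ⟨e, f, h.areClones_of_twins he hf hef hB fun g ↦
        iff_of_false (hedge e g) (hedge f g)⟩
    have h1 : 1 < M.E.encard := lt_of_lt_of_le (by norm_num) h2
    obtain ⟨e, f, he, hf, hef⟩ := one_lt_encard_iff.1 h1
    by_contra hcon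
    have hne : ∀ e ∈ M.E, ∀ f ∈ M.E, e ≠ f → ¬ (e ∈ B ↔ f ∈ B) :=
      fun e he f hf hef hB ↦ hcon (htwins e he f hf hef hB)
    have hE : M.E = {e, f} := by
      refine Subset.antisymm (fun g hg ↦ ?_) (by simp [insert_subset_iff, he, hf])
      by_contra hgef
      rw [mem_insert_iff, mem_singleton_iff, not_or] at hgef
      have h1 := hne g hg e he hgef.1
      have h2 := hne g hg f hf hgef.2
      have h3 := hne e he f hf hef
      tauto
    by_cases heB : e ∈ B
    · have hfB : f ∉ B := fun hfB ↦ hne e he f hf hef (iff_of_true heB hfB)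
      exact hlc (h.isLoopPlusColoop (hE.trans (pair_comm e f)) hfB heB (hedge e f))
    · have hfB : f ∈ B := by
        by_contra hfB
        exact hne e he f hf hef (iff_of_false heB hfB)
      exact hlc (h.isLoopPlusColoop hE heB hfB (hedge f e))

end IsStandard

end Matroid

end

/-- A finite binary matroid has no `M(K₄)`-minor if and only if it is clone reducible. -/
theorem proposition4p8 {α : Type*} (M : Matroid α) (hfin : M.Finite) (hbin : M.IsBinary) :
    ¬ M.HasMK4Minor ↔ M.IsCloneReducible := by
  constructor
  · intro hK N hNM h2 hlc
    obtain ⟨n, v, hv⟩ := hbin.exists_represents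
    obtain ⟨U, hU⟩ := hv.exists_of_isMinor hNM
    obtain ⟨B, hB⟩ := N.exists_isBase
    obtain ⟨w, hw, hwB, hw0⟩ := hU.exists_standard hB
    have hstd : Matroid.IsStandard w N B := ⟨hw, hB, hwB, hw0⟩
    refine hstd.exists_areClones ⟨hfin.ground_finite.subset hNM.subset⟩ ?_ h2 hlc
    rintro ⟨K, hK', hiso⟩
    exact hK ⟨K, hK'.trans hNM, hiso⟩
  · rintro hM ⟨N, hNM, hiso⟩
    -- The count shows that the minor is large enough and is not the exceptional loop plus coloop.
    have hcard : N.E.encard = 6 := by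
      obtain ⟨φ, -⟩ := hiso
      have h1 : N.E.encard = ((⊤ : SimpleGraph (Fin 4)).edgeSet).encard := Set.encard_congr φ
      rw [h1, ← SimpleGraph.coe_edgeFinset, Set.encard_coe_eq_coe_finsetCard]
      decide
    obtain ⟨e, f, hef⟩ := hM N hNM (by rw [hcard]; norm_num) (by
      rintro ⟨e, f, hef, hE, -⟩
      rw [hE, Set.encard_pair hef] at hcard
      norm_num at hcard)
    exact Matroid.not_areClones_of_isIsomorphic_cycleMatroid_top hiso e f hef
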